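/- Let $d\ge 2$, let $A$ and $B$ be quantum systems with Hilbert space $\mathbb C^d$ each, and let $C$ (the mediator) be a quantum system with an arbitrary finite-dimensional Hilbert space. Let $H_{AC}$ and $H_{BC}$ be Hermitian operators on $A\otimes C$ and $B\otimes C$, and let $M=H_{AC}\otimes 1_B+H_{BC}\otimes 1_A$ be the resulting (dimensionless, time-independent) Hamiltonian on $A\otimes B\otimes C$. Let $|\alpha\rangle\in A$, $|\beta\rangle\in B$ be unit vectors, $\rho_C$ a density matrix on $C$, and $\rho(0)=|\alpha\beta\rangle\langle\alpha\beta|\otimes\rho_C$. Assume resource equality, $\min\{\langle M\rangle,\Delta M\}=1$, where $\langle M\rangle=\mathrm{tr}(M\rho(0))-E_g$ with $E_g$ the smallest eigenvalue of $M$, and $\Delta M=\sqrt{\mathrm{tr}(M^2\rho(0))-\mathrm{tr}(M\rho(0))^2}$. Let $\rho(T)=e^{-iTM}\rho(0)e^{iTM}$, and let $\Gamma_{\mathcal{CMI}}\in[0,\infty]$ be the infimum of all $T\ge 0$ for which $\mathrm{tr}_C\,\rho(T)=|\Psi\rangle\langle\Psi|$ is maximally entangled, i.e. $|\Psi\rangle=\frac1{\sqrt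 d}\sum_{j=0}^{d-1}|x_j\rangle|y_j\rangle$ for some orthonormal bases $\{|x_j\rangle\}$ of $A$ and $\{|y_j\rangle\}$ of $B$ ($\Gamma_{\mathcal{CMI}}=\infty$ if there is no such $T$). Then $$\Gamma_{\mathcal{CMI}}>\arccos\left(1/\sqrt d\right).$$ -/

import Mathlib

open scoped Kronecker ENNReal NNReal ComplexOrder

noncomputable section

namespace MediatedEntangling

/-- `σ` is a density matrix: positive semidefinite with unit trace. -/
def IsDensityMatrix {ι : Type*} [Fintype ι] (σ : Matrix ι ι ℂ) : Prop :=
  σ.PosSemidef ∧ σ.trace = 1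

/-- The rank-one operator `|ψ⟩⟨ψ|`. -/
def ketbra {ι : Type*} (ψ : ι → ℂ) : Matrix ι ι ℂ :=
  Matrix.vecMulVec ψ (star ψ)

/-- The product vector `|α β⟩ = |α⟩ ⊗ |β⟩` of the principal systems. -/
def productKet {d : ℕ} (α β : EuclideanSpace ℂ (Fin d)) : Fin d × Fin d → ℂ :=
  fun p => α p.1 * β p.2

/-- An operator on `A ⊗ C`, acting on `(A ⊗ B) ⊗ C` as the identity on `B`. -/
def onAC {d : ℕ} {κ : Type*} (X : Matrix (Fin d × κ) (Fin d × κ) ℂ) :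
    Matrix ((Fin d × Fin d) × κ) ((Fin d × Fin d) × κ) ℂ :=
  Matrix.of fun p q => if p.1.2 = q.1.2 then X (p.1.1, p.2) (q.1.1, q.2) else 0

/-- An operator on `B ⊗ C`, acting on `(A ⊗ B) ⊗ C` as the identity on `A`. -/
def onBC {d : ℕ} {κ : Type*} (X : Matrix (Fin d × κ) (Fin d × κ) ℂ) :
    Matrix ((Fin d × Fin d) × κ) ((Fin d × Fin d) × κ) ℂ :=
  Matrix.of fun p q => if p.1.1 = q.1.1 then X (p.1.2, p.2) (q.1.2, q.2) else 0

/-- The partial trace over the second tensor factor. -/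
def traceRight {ι κ : Type*} [Fintype κ] (σ : Matrix (ι × κ) (ι × κ) ℂ) : Matrix ι ι ℂ :=
  Matrix.of fun i j => ∑ c, σ (i, c) (j, c)

/-- The state at dimensionless time `T` under the dimensionless Hamiltonian `M`:
`exp(-i T M) ρ exp(-i T M)†`. -/
def evolve {ι : Type*} [Fintype ι] [DecidableEq ι] (M ρ : Matrix ι ι ℂ) (T : ℝ) :
    Matrix ι ι ℂ :=
  NormedSpace.exp ((-(Complex.I * (T : ℂ))) • M) * ρ *
    (NormedSpace.exp ((-(Complex.I * (T : ℂ))) • M)).conjTranspose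

/-- The ground level: the smallest point of the (finite) spectrum of a Hermitian matrix. -/
def groundEnergy {ι : Type*} [Fintype ι] [DecidableEq ι] (M : Matrix ι ι ℂ) : ℝ :=
  sInf (spectrum ℝ M)

/-- The mean energy in the state `ρ`, relative to the ground level. -/
def meanEnergy {ι : Type*} [Fintype ι] [DecidableEq ι] (M ρ : Matrix ι ι ℂ) : ℝ :=
  (M * ρ).trace.re - groundEnergy M

/-- The standard deviation of the energy in the state `ρ`. -/
def energySD {ι : Type*} [Fintype ι] (M ρ : Matrix ι ι ℂ) : ℝ :=
  Real.sqrt ((M * M * ρ).trace.re - (M * ρ).trace.re ^ 2)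

/-- Resource equality: `min {⟨M⟩, ΔM} = 1` in the initial state `ρ`. -/
def ResourceEquality {ι : Type*} [Fintype ι] [DecidableEq ι] (M ρ : Matrix ι ι ℂ) : Prop :=
  min (meanEnergy M ρ) (energySD M ρ) = 1

/-- `σ = |Ψ⟩⟨Ψ|` with `|Ψ⟩ = d^{-1/2} ∑ⱼ |xⱼ⟩|yⱼ⟩` for orthonormal bases `x` of `A`, `y` of `B`. -/
def IsMaximallyEntangled {d : ℕ} (σ : Matrix (Fin d × Fin d) (Fin d × Fin d) ℂ) : Prop :=
  ∃ x y : OrthonormalBasis (Fin d) ℂ (EuclideanSpace ℂ (Fin d)),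
    σ = ketbra fun p => (((Real.sqrt d)⁻¹ : ℝ) : ℂ) * ∑ j, productKet (x j) (y j) p

/-- The time required to maximally entangle `A` and `B`: the infimum of all times `T ≥ 0` at which
the reduced state of `AB` is maximally entangled (`∞` if this never happens). -/
def entanglingTime {d : ℕ} {κ : Type*} [Fintype κ] [DecidableEq κ]
    (M ρ : Matrix ((Fin d × Fin d) × κ) ((Fin d × Fin d) × κ) ℂ) : ℝ≥0∞ :=
  ⨅ (T : ℝ≥0) (_ : IsMaximallyEntangled (traceRight (evolve M ρ T))), (T : ℝ≥0∞)

end MediatedEntangling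

end

/-! Write `ρC = G * Gᴴ`, so that the initial state is carried by the vector family `αβ ⊗ G`. At a
time `T` when the reduced state of `AB` is pure and maximally entangled, the evolved family is `P ⊗
G'`. The overlap `w` of `αβ` with `P` satisfies `‖w‖ ≤ 1/√d`, and ordinary speed limits would use
only this. The absence of a direct `A`–`B` coupling gives more: a vector `Y ⊗ G'` in which both `A`
and `B` are orthogonal to their initial states is orthogonal to the initial vector `s` and also to
`M s` (`hamiltonian_orthogonal`). Such a test vector annihilates every affine function of the energy
applied to `s`, yet it overlaps the evolved vector.

Resource equality makes one of the two resources equal to 1. If it is the spread, the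
Mandelstam–Tamm bound gives `T ≥ arccos (1/√d)`, with equality only if the energies in use sit at
two points. There the propagator is affine in the energy, which the test vector excludes
(`mandelstam_tamm_strict`).

If it is the mean, Cauchy–Schwarz against the test vector sharpens Margolus–Levitin
(`margolus_levitin_refined`). This needs the energy of the test vector to be at most that of `s`.
For a fixed mediator state all maximally entangled vectors have equal energy, since their marginals
are maximally mixed; by conservation it is the initial energy. A signed average of them costs no
more by convexity. The resulting inequality contradicts `T ≤ arccos (1/√d)` numerically, with
separate test vectors for `d = 2` and `d ≥ 3`.

Each admissible time thus exceeds the bound strictly. The set of admissible times can be enlarged to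
a closed one with the same property, so strictness survives the infimum. -/

namespace MediatedEntangling

/-! ### Trigonometric inequalities -/

/-- The Cusa–Huygens inequality. -/
theorem three_mul_sin_le {t : ℝ} (h0 : 0 ≤ t) (hpi : t ≤ Real.pi) :
    3 * Real.sin t ≤ t * (2 + Real.cos t) := by
  have hmono1 : MonotoneOn (fun t : ℝ => Real.sin t - t * Real.cos t) (Set.Icc 0 Real.pi) := by
    refine monotoneOn_of_hasDerivWithinAt_nonneg (f' := fun t => t * Real.sin t)
      (convex_Icc _ _) (by fun_prop) ?_ ?_
    · intro x _
      have := (Real.hasDerivAt_sin x).sub ((hasDerivAt_id x).mul (Real.hasDerivAt_cos x))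
      refine (this.congr_deriv ?_).hasDerivWithinAt
      simp
    · intro x hx
      rw [interior_Icc] at hx
      exact mul_nonneg hx.1.le (Real.sin_nonneg_of_nonneg_of_le_pi hx.1.le hx.2.le)
  have h1 : ∀ x ∈ Set.Icc 0 Real.pi, 0 ≤ Real.sin x - x * Real.cos x := by
    intro x hx
    simpa using hmono1 (Set.left_mem_Icc.2 Real.pi_pos.le) hx hx.1
  have hmono2 : MonotoneOn (fun t : ℝ => 2 - 2 * Real.cos t - t * Real.sin t)
      (Set.Icc 0 Real.pi) := by
    refine monotoneOn_of_hasDerivWithinAt_nonneg (f' := fun t => Real.sin t - t * Real.cos t)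
      (convex_Icc _ _) (by fun_prop) ?_ ?_
    · intro x _
      have := (((Real.hasDerivAt_cos x).const_mul 2).const_sub 2).sub
        ((hasDerivAt_id x).mul (Real.hasDerivAt_sin x))
      refine (this.congr_deriv ?_).hasDerivWithinAt
      simp; ring
    · intro x hx
      exact h1 x (interior_subset hx)
  have h2 : ∀ x ∈ Set.Icc 0 Real.pi, 0 ≤ 2 - 2 * Real.cos x - x * Real.sin x := by
    intro x hx
    simpa using hmono2 (Set.left_mem_Icc.2 Real.pi_pos.le) hx hx.1
  have hmono3 : MonotoneOn (fun t : ℝ => t * (2 + Real.cos t) - 3 * Real.sin t)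
      (Set.Icc 0 Real.pi) := by
    refine monotoneOn_of_hasDerivWithinAt_nonneg
      (f' := fun t => 2 - 2 * Real.cos t - t * Real.sin t)
      (convex_Icc _ _) (by fun_prop) ?_ ?_
    · intro x _
      have := ((hasDerivAt_id x).mul ((Real.hasDerivAt_cos x).const_add 2)).sub
        ((Real.hasDerivAt_sin x).const_mul 3)
      refine (this.congr_deriv ?_).hasDerivWithinAt
      simp; ring
    · intro x hx
      exact h2 x (interior_subset hx)
  have := hmono3 (Set.left_mem_Icc.2 Real.pi_pos.le) (⟨h0, hpi⟩ : t ∈ Set.Icc 0 Real.pi) h0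
  simp at this
  linarith

/-- Half-angle form of the bound on `|exp (-ix) - 1| ^ 2` used for the mean energy. Up to `π`, the
difference of the sides is a concave quadratic in `sin t`, and Cusa–Huygens confines `sin t` to an
interval `[0, D]` at whose ends it is nonnegative. -/
theorem sin_sq_le {t : ℝ} (h0 : 0 ≤ t) :
    Real.sin t ^ 2 ≤ 9 / 20 * t ^ 2 + 3 / 5 * t * (Real.sin t * Real.cos t) := by
  rcases le_or_gt t Real.pi with hpi | hpi
  · have hs := Real.sin_nonneg_of_nonneg_of_le_pi h0 hpi
    have hc := three_mul_sin_le h0 hpi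
    set s := Real.sin t
    set c := Real.cos t
    have hc1 : -1 ≤ c := Real.neg_one_le_cos t
    have hc2 : c ≤ 1 := Real.cos_le_one t
    set D := t * (2 + c) / 3 with hD
    have hsD : s ≤ D := by rw [hD]; linarith
    -- the concave quadratic in `s` is nonnegative at `0` and at `D`
    have key : 0 ≤ 9 / 20 * t ^ 2 + 3 / 5 * t * (D * c) - D ^ 2 := by
      -- The coefficients 9/20 and 3/5 make this a perfect square in `c`, up to a positive factor.
      have : 9 / 20 * t ^ 2 + 3 / 5 * t * (D * c) - D ^ 2 = 4 / 45 * t ^ 2 * (c - 1 / 4) ^ 2 := by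
        rw [hD]; ring
      rw [this]; positivity
    rcases eq_or_lt_of_le h0 with rfl | ht
    · have : s = 0 := Real.sin_zero
      rw [this]; simp
    have hDpos : 0 < D := by rw [hD]; have : 0 < 2 + c := by linarith
                             positivity
    have : 0 ≤ D * (9 / 20 * t ^ 2 + 3 / 5 * t * (s * c) - s ^ 2) := by
      have e : D * (9 / 20 * t ^ 2 + 3 / 5 * t * (s * c) - s ^ 2)
          = s * (9 / 20 * t ^ 2 + 3 / 5 * t * (D * c) - D ^ 2)
            + (D - s) * (9 / 20 * t ^ 2) + s * D * (D - s) := by ring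
      rw [e]
      have := sub_nonneg.2 hsD
      positivity
    have := nonneg_of_mul_nonneg_right this hDpos
    linarith
  · have h3 : 3 < t := lt_trans Real.pi_gt_three hpi
    have h1 : -(1 / 2) ≤ Real.sin t * Real.cos t := by
      nlinarith [Real.sin_sq_add_cos_sq t, sq_nonneg (Real.sin t + Real.cos t)]
    have h2 : Real.sin t ^ 2 ≤ 1 := by
      nlinarith [Real.sin_sq_add_cos_sq t, sq_nonneg (Real.cos t)]
    nlinarith [mul_le_mul_of_nonneg_left h1 h0]

theorem two_mul_one_sub_cos_le {x : ℝ} (hx : 0 ≤ x) :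
    2 * (1 - Real.cos x) ≤ x * (9 / 20 * x + 3 / 5 * Real.sin x) := by
  have h := sin_sq_le (t := x / 2) (by linarith)
  have e : x = 2 * (x / 2) := by ring
  have hc : Real.cos x = 1 - 2 * Real.sin (x / 2) ^ 2 := by
    rw [e, Real.cos_two_mul, Real.cos_sq']; ring_nf
  have hs : Real.sin x = 2 * Real.sin (x / 2) * Real.cos (x / 2) := by
    conv_lhs => rw [e, Real.sin_two_mul]
  rw [hc, hs]
  nlinarith

/-- Strict concavity of the sine makes `sin t / t` strictly decreasing. -/
theorem mul_sin_lt_mul_sin {a b : ℝ} (ha : 0 < a) (hab : a < b) (hb : b ≤ Real.pi) :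
    a * Real.sin b < b * Real.sin a := by
  have hb0 : 0 < b := ha.trans hab
  have h := strictConcaveOn_sin_Icc.2 (Set.left_mem_Icc.2 Real.pi_pos.le)
    (⟨hb0.le, hb⟩ : b ∈ Set.Icc 0 Real.pi) hb0.ne
    (show 0 < 1 - a / b by rw [sub_pos, div_lt_one hb0]; exact hab) (div_pos ha hb0) (by ring)
  simp only [smul_eq_mul, Real.sin_zero, mul_zero, zero_add] at h
  rw [div_mul_cancel₀ _ hb0.ne', div_mul_eq_mul_div, div_lt_iff₀ hb0] at h
  linarith

/-- The even parabola is tangent to the cosine at `θ`. The derivative of the difference is `s * y -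
sin y` with `s = sin θ / θ`, which changes sign on the positive axis only at `θ` because `sin y / y`
decreases. -/
theorem cos_gt_parabola {θ x : ℝ} (hθ : 0 < θ) (hθ2 : θ ≤ Real.pi / 2) (hx : 0 ≤ x) (hne : x ≠ θ) :
    Real.cos θ + Real.sin θ / (2 * θ) * (θ ^ 2 - x ^ 2) < Real.cos x := by
  have hpi := Real.pi_pos
  set s := Real.sin θ / θ with hs
  have hsθ : s * θ = Real.sin θ := by rw [hs]; field_simp
  set f : ℝ → ℝ := fun y => Real.cos y + s / 2 * y ^ 2 with hf
  have hderiv : ∀ y, HasDerivAt f (s * y - Real.sin y) y := by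
    intro y
    have := (Real.hasDerivAt_cos y).add (((hasDerivAt_id y).pow 2).const_mul (s / 2))
    refine this.congr_deriv ?_
    simp; ring
  have hcont : Continuous f := continuous_iff_continuousAt.2 fun y => (hderiv y).continuousAt
  suffices f θ < f x by
    have e : Real.sin θ / (2 * θ) = s / 2 := by rw [hs]; field_simp
    rw [e]
    simp only [hf] at this
    linarith
  rcases lt_or_gt_of_ne hne with h | h
  · have : StrictAntiOn f (Set.Icc 0 θ) := by
      refine strictAntiOn_of_deriv_neg (convex_Icc _ _) hcont.continuousOn fun y hy => ?_
      rw [interior_Icc] at hy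
      rw [(hderiv y).deriv]
      have := mul_sin_lt_mul_sin hy.1 hy.2 (by linarith)
      rw [← hsθ] at this
      nlinarith [hy.1, hy.2]
    exact this ⟨hx, h.le⟩ ⟨hθ.le, le_rfl⟩ h
  · have : StrictMonoOn f (Set.Ici θ) := by
      refine strictMonoOn_of_deriv_pos (convex_Ici _) hcont.continuousOn fun y hy => ?_
      rw [interior_Ici] at hy
      have hy' : θ < y := hy
      rw [(hderiv y).deriv]
      rcases le_or_gt y Real.pi with hyp | hyp
      · have := mul_sin_lt_mul_sin hθ hy' hyp
        rw [← hsθ] at this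
        nlinarith
      -- Beyond `π` Jordan's inequality `2/π ≤ sin θ / θ` suffices: `s * y ≥ 2`, while the sine is
      -- at most 1.
      · have h2 := Real.mul_le_sin hθ.le hθ2
        have h3 : 2 / Real.pi ≤ s := by rw [hs, le_div_iff₀ hθ]; exact h2
        have h4 : 2 ≤ s * y := by
          calc (2 : ℝ) = 2 / Real.pi * Real.pi := by field_simp
            _ ≤ s * y := mul_le_mul h3 hyp.le hpi.le (le_trans (by positivity) h3)
        linarith [Real.sin_le_one y]
    exact this (Set.self_mem_Ici) h.le h

theorem cos_ge_parabola {θ : ℝ} (hθ : 0 < θ) (hθ2 : θ ≤ Real.pi / 2) (x : ℝ) :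
    Real.cos θ + Real.sin θ / (2 * θ) * (θ ^ 2 - x ^ 2) ≤ Real.cos x := by
  rw [← Real.cos_abs x, ← sq_abs x]
  rcases eq_or_ne |x| θ with h | h
  · rw [h]; simp
  · exact (cos_gt_parabola hθ hθ2 (abs_nonneg x) h).le

/-! ### Speed limits for a spectral distribution, with a test vector -/

open Complex in
/-- A refinement of the Margolus–Levitin bound: the `λ i` are energies with weights `|s i|²`, and `q`
is a test vector of energy at most `m`, orthogonal to both `s` and `λ s`. -/
theorem margolus_levitin_refined {ι : Type*} [Fintype ι] (l : ι → ℝ) (s q : ι → ℂ) {m : ℝ}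
    (hl : ∀ i, 0 ≤ l i) (hm : 0 < m) (hs : ∑ i, ‖s i‖ ^ 2 = 1) (hsl : ∑ i, l i * ‖s i‖ ^ 2 = m)
    (hq : ∑ i, l i * ‖q i‖ ^ 2 ≤ m) (hqs : ∑ i, star (q i) * s i = 0)
    (hqls : ∑ i, star (q i) * (l i * s i) = 0) :
    ‖∑ i, star (q i) * (exp (-(I * l i)) * s i)‖ ^ 2
      + (1 - ∑ i, Real.cos (l i) * ‖s i‖ ^ 2) ^ 2 + (∑ i, Real.sin (l i) * ‖s i‖ ^ 2) ^ 2
      ≤ 9 / 20 * m ^ 2 + 3 / 5 * m * ∑ i, Real.sin (l i) * ‖s i‖ ^ 2 := by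
  set a := ∑ i, Real.cos (l i) * ‖s i‖ ^ 2 with ha
  set b := ∑ i, Real.sin (l i) * ‖s i‖ ^ 2 with hb
  -- The slope `B = (z - 1) / m`, where `z = a - ib` is the survival amplitude, minimises the final
  -- Cauchy–Schwarz bound; the minimum produces the terms `(1 - a) ^ 2 + b ^ 2`.
  set x := (a - 1) / m with hx
  set y := -b / m with hy
  set B : ℂ := ⟨x, y⟩ with hB
  set H : ι → ℝ := fun i => 9 / 20 * l i + 3 / 5 * Real.sin (l i)
    - 2 * (x * (Real.cos (l i) - 1) - y * Real.sin (l i)) + (x ^ 2 + y ^ 2) * l i with hH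
  have hexp : ∀ t : ℝ, exp (-(I * t)) = ⟨Real.cos t, -Real.sin t⟩ := by
    intro t
    have : -(I * (t : ℂ)) = ((-t : ℝ) : ℂ) * I := by push_cast; ring
    rw [this, exp_mul_I]
    apply Complex.ext <;> simp [← ofReal_cos, ← ofReal_sin, -ofReal_neg]
  have hpt : ∀ i, ‖exp (-(I * l i)) - 1 - B * l i‖ ^ 2 ≤ l i * H i := by
    intro i
    rw [hexp, ← normSq_eq_norm_sq, normSq_apply]
    simp only [hB, sub_re, sub_im, one_re, one_im, mul_re, mul_im, ofReal_re, ofReal_im]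
    have h1 := two_mul_one_sub_cos_le (hl i)
    have h2 := Real.sin_sq_add_cos_sq (l i)
    simp only [hH]
    nlinarith
  have hlH : ∀ i, 0 ≤ l i * H i := fun i => (sq_nonneg _).trans (hpt i)
  have hHn : ∀ i, l i ≠ 0 → 0 ≤ H i := fun i hi =>
    nonneg_of_mul_nonneg_right (hlH i) (lt_of_le_of_ne (hl i) (Ne.symm hi))
  have hH0 : ∀ i, 0 ≤ H i := by
    intro i
    by_cases hi : l i = 0
    · simp [hH, hi]
    · exact hHn i hi
  -- Orthogonality to `s` and `λ s` permits subtracting any affine function of `λ`. The remainder is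
  -- at most `√λ √H`, and Cauchy–Schwarz then puts the weight `λ` on `q` and `H` on `s`.
  have hk : ∑ i, star (q i) * (exp (-(I * l i)) * s i)
      = ∑ i, star (q i) * ((exp (-(I * l i)) - 1 - B * l i) * s i) := by
    have : ∀ i, star (q i) * ((exp (-(I * l i)) - 1 - B * l i) * s i)
        = star (q i) * (exp (-(I * l i)) * s i) - star (q i) * s i
          - B * (star (q i) * (l i * s i)) := fun i => by ring
    simp only [this, Finset.sum_sub_distrib, ← Finset.mul_sum, hqs, hqls]
    ring
  have hn : ‖∑ i, star (q i) * (exp (-(I * l i)) * s i)‖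
      ≤ ∑ i, (Real.sqrt (l i) * ‖q i‖) * (Real.sqrt (H i) * ‖s i‖) := by
    rw [hk]
    refine (norm_sum_le _ _).trans (Finset.sum_le_sum fun i _ => ?_)
    rw [norm_mul, norm_mul, norm_star]
    have : ‖exp (-(I * l i)) - 1 - B * l i‖ ≤ Real.sqrt (l i) * Real.sqrt (H i) := by
      rw [← Real.sqrt_mul (hl i)]
      exact Real.le_sqrt_of_sq_le (hpt i)
    calc ‖q i‖ * (‖exp (-(I * l i)) - 1 - B * l i‖ * ‖s i‖)
        ≤ ‖q i‖ * ((Real.sqrt (l i) * Real.sqrt (H i)) * ‖s i‖) := by gcongr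
      _ = _ := by ring
  have hcs := Finset.sum_mul_sq_le_sq_mul_sq Finset.univ (fun i => Real.sqrt (l i) * ‖q i‖)
    (fun i => Real.sqrt (H i) * ‖s i‖)
  simp only [mul_pow, Real.sq_sqrt (hl _), Real.sq_sqrt (hH0 _)] at hcs
  have hHs : ∑ i, H i * ‖s i‖ ^ 2
      = 9 / 20 * m + 3 / 5 * b - 2 * (x * (a - 1) - y * b) + (x ^ 2 + y ^ 2) * m := by
    have : ∀ i, H i * ‖s i‖ ^ 2 = 9 / 20 * (l i * ‖s i‖ ^ 2) + 3 / 5 * (Real.sin (l i) * ‖s i‖ ^ 2)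
        - 2 * (x * (Real.cos (l i) * ‖s i‖ ^ 2 - ‖s i‖ ^ 2) - y * (Real.sin (l i) * ‖s i‖ ^ 2))
        + (x ^ 2 + y ^ 2) * (l i * ‖s i‖ ^ 2) := fun i => by simp only [hH]; ring
    simp only [this, Finset.sum_sub_distrib, Finset.sum_add_distrib, ← Finset.mul_sum, hs, hsl,
      ← ha, ← hb]
  have hHs0 : 0 ≤ ∑ i, H i * ‖s i‖ ^ 2 :=
    Finset.sum_nonneg fun i _ => mul_nonneg (hH0 i) (sq_nonneg _)
  have hfin : ‖∑ i, star (q i) * (exp (-(I * l i)) * s i)‖ ^ 2 ≤ m * ∑ i, H i * ‖s i‖ ^ 2 :=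
    (pow_le_pow_left₀ (norm_nonneg _) hn 2).trans
      (hcs.trans (mul_le_mul_of_nonneg_right hq hHs0))
  have hval : m * ∑ i, H i * ‖s i‖ ^ 2
      = 9 / 20 * m ^ 2 + 3 / 5 * m * b - ((1 - a) ^ 2 + b ^ 2) := by
    rw [hHs, hx, hy]; field_simp; ring
  linarith

/-- The first half of the Mandelstam–Tamm bound, in terms of the parabola touching the cosine at `θ`. -/
theorem cos_le_sum_cos {ι : Type*} [Fintype ι] (l : ι → ℝ) (s : ι → ℂ) {θ : ℝ}
    (hθ : 0 < θ) (hθ2 : θ ≤ Real.pi / 2) (hs : ∑ i, ‖s i‖ ^ 2 = 1)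
    (hsl : ∑ i, l i ^ 2 * ‖s i‖ ^ 2 ≤ θ ^ 2) :
    Real.cos θ ≤ ∑ i, (Real.cos θ + Real.sin θ / (2 * θ) * (θ ^ 2 - l i ^ 2)) * ‖s i‖ ^ 2 := by
  set r := Real.sin θ / (2 * θ) with hr
  have hr0 : 0 ≤ r := div_nonneg
    (Real.sin_nonneg_of_nonneg_of_le_pi hθ.le (by linarith [Real.pi_pos])) (by linarith)
  have hsum : ∑ i, (Real.cos θ + r * (θ ^ 2 - l i ^ 2)) * ‖s i‖ ^ 2
      = Real.cos θ + r * (θ ^ 2 - ∑ i, l i ^ 2 * ‖s i‖ ^ 2) := by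
    have : ∀ i, (Real.cos θ + r * (θ ^ 2 - l i ^ 2)) * ‖s i‖ ^ 2
        = (Real.cos θ + r * θ ^ 2) * ‖s i‖ ^ 2 - r * (l i ^ 2 * ‖s i‖ ^ 2) := fun i => by ring
    simp only [this, Finset.sum_sub_distrib, ← Finset.mul_sum, hs]
    ring
  rw [hsum]
  nlinarith

theorem mandelstam_tamm {ι : Type*} [Fintype ι] (l : ι → ℝ) (s : ι → ℂ) {θ : ℝ}
    (hθ : 0 < θ) (hθ2 : θ ≤ Real.pi / 2) (hs : ∑ i, ‖s i‖ ^ 2 = 1)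
    (hsl : ∑ i, l i ^ 2 * ‖s i‖ ^ 2 ≤ θ ^ 2) :
    Real.cos θ ≤ ∑ i, Real.cos (l i) * ‖s i‖ ^ 2 :=
  (cos_le_sum_cos l s hθ hθ2 hs hsl).trans (Finset.sum_le_sum fun i _ =>
    mul_le_mul_of_nonneg_right (cos_ge_parabola hθ hθ2 (l i)) (sq_nonneg _))

open Complex in
/-- The Mandelstam–Tamm bound is not saturated when there is a test vector orthogonal to `s` and
`λ s`, but not to the evolved vector. -/
theorem mandelstam_tamm_strict {ι : Type*} [Fintype ι] (l : ι → ℝ) (s q : ι → ℂ) {θ : ℝ}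
    (hθ : 0 < θ) (hθ2 : θ ≤ Real.pi / 2) (hs : ∑ i, ‖s i‖ ^ 2 = 1)
    (hsl : ∑ i, l i ^ 2 * ‖s i‖ ^ 2 ≤ θ ^ 2) (hqs : ∑ i, star (q i) * s i = 0)
    (hqls : ∑ i, star (q i) * (l i * s i) = 0)
    (hq : ∑ i, star (q i) * (exp (-(I * l i)) * s i) ≠ 0) :
    Real.cos θ < ∑ i, Real.cos (l i) * ‖s i‖ ^ 2 := by
  refine lt_of_le_of_lt (cos_le_sum_cos l s hθ hθ2 hs hsl) (Finset.sum_lt_sum (fun i _ => mul_le_mul_of_nonneg_right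
    (cos_ge_parabola hθ hθ2 _) (sq_nonneg _)) ?_)
  by_contra! hcon
  -- otherwise `exp (-i λ)` agrees with an affine function of `λ` on the support of `s`
  apply hq
  have hsupp : ∀ i, exp (-(I * l i)) * s i
      = (Real.cos θ : ℂ) * s i - I * (Real.sin θ / θ : ℝ) * (l i * s i) := by
    intro i
    by_cases hi : s i = 0
    · simp [hi]
    -- The parabola lies strictly below the cosine away from `±θ`, so no weight can sit elsewhere.
    have habs : |l i| = θ := by
      by_contra hne
      have h1 := cos_gt_parabola hθ hθ2 (abs_nonneg (l i)) hne
      rw [Real.cos_abs, sq_abs] at h1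
      have h2 := hcon i (Finset.mem_univ i)
      have h3 : 0 < ‖s i‖ ^ 2 := by positivity
      exact absurd (mul_lt_mul_of_pos_right h1 h3) (not_lt.2 h2)
    rw [← mul_assoc, ← sub_mul]
    congr 1
    have hθc : (θ : ℂ) ≠ 0 := by exact_mod_cast hθ.ne'
    rcases (abs_eq hθ.le).1 habs with h | h
    · rw [h, show -(I * (θ : ℂ)) = (-(θ : ℂ)) * I by ring, exp_mul_I, cos_neg, sin_neg]
      push_cast
      field_simp
      ring
    · rw [h, show -(I * ((-θ : ℝ) : ℂ)) = (θ : ℂ) * I by push_cast; ring, exp_mul_I]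
      push_cast
      field_simp
      ring
  have : ∀ i, star (q i) * (exp (-(I * l i)) * s i) = (Real.cos θ : ℂ) * (star (q i) * s i)
      - I * (Real.sin θ / θ : ℝ) * (star (q i) * (l i * s i)) := fun i => by rw [hsupp]; ring
  simp only [this, Finset.sum_sub_distrib, ← Finset.mul_sum, hqs, hqls, mul_zero, sub_zero]

/-! ### Product states across `AB : C` and Hamiltonians without `A`–`B` coupling -/

open Matrix

variable {d : ℕ} {κ μ : Type*}

/-- The tensor product of a vector of `A ⊗ B`, given by its coefficient matrix, with a family of
vectors of `C`, given by the columns of `G`. -/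
def tensorState (X : Matrix (Fin d) (Fin d) ℂ) (G : Matrix κ μ ℂ) :
    Matrix ((Fin d × Fin d) × κ) μ ℂ :=
  Matrix.of fun p l => X p.1.1 p.1.2 * G p.2 l

/-- The partial matrix elements of `H` between families of vectors of the second factor. -/
def contractRight [Fintype κ] [Fintype μ] (H : Matrix (Fin d × κ) (Fin d × κ) ℂ) (G' G : Matrix κ μ ℂ) :
    Matrix (Fin d) (Fin d) ℂ :=
  Matrix.of fun a a' => ∑ l, ∑ c, ∑ c', star (G' c l) * H (a, c) (a', c') * G c' l

theorem onAC_mul_tensorState [Fintype κ] (H : Matrix (Fin d × κ) (Fin d × κ) ℂ)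
    (X : Matrix (Fin d) (Fin d) ℂ) (G : Matrix κ μ ℂ) (a b : Fin d) (c : κ) (l : μ) :
    (onAC H * tensorState X G) ((a, b), c) l
      = ∑ a', ∑ c', H (a, c) (a', c') * (X a' b * G c' l) := by
  simp only [mul_apply, onAC, tensorState, of_apply, Fintype.sum_prod_type, ite_mul, zero_mul]
  refine Finset.sum_congr rfl fun a' _ => ?_
  rw [Finset.sum_comm]
  simp

theorem onBC_mul_tensorState [Fintype κ] (H : Matrix (Fin d × κ) (Fin d × κ) ℂ)
    (X : Matrix (Fin d) (Fin d) ℂ) (G : Matrix κ μ ℂ) (a b : Fin d) (c : κ) (l : μ) :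
    (onBC H * tensorState X G) ((a, b), c) l
      = ∑ b', ∑ c', H (b, c) (b', c') * (X a b' * G c' l) := by
  simp only [mul_apply, onBC, tensorState, of_apply, Fintype.sum_prod_type, ite_mul, zero_mul]
  rw [Finset.sum_comm]
  refine Finset.sum_congr rfl fun b' _ => ?_
  rw [Finset.sum_comm]
  simp

/-- An operator acting trivially on `B` sees the two coefficient matrices only through `X * Yᴴ`, a
partial trace over `B`. The energy arguments depend on this and on its counterpart for `onBC`. -/
theorem trace_tensorState_onAC [Fintype κ] [Fintype μ] (H : Matrix (Fin d × κ) (Fin d × κ) ℂ)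
    (X Y : Matrix (Fin d) (Fin d) ℂ) (G G' : Matrix κ μ ℂ) :
    ((tensorState Y G')ᴴ * (onAC H * tensorState X G)).trace
      = (contractRight H G' G * (X * Yᴴ)).trace := by
  simp only [trace, diag_apply, mul_apply (M := (tensorState Y G')ᴴ), Fintype.sum_prod_type,
    onAC_mul_tensorState]
  simp only [mul_apply, contractRight, tensorState, of_apply, conjTranspose_apply,
    Finset.mul_sum, Finset.sum_mul, star_mul', ← Fintype.sum_prod_type']
  let e : μ × Fin d × Fin d × κ × Fin d × κ ≃ Fin d × Fin d × Fin d × μ × κ × κ :=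
    { toFun := fun x => (x.2.1, x.2.2.2.2.1, x.2.2.1, x.1, x.2.2.2.1, x.2.2.2.2.2)
      invFun := fun x => (x.2.2.2.1, x.1, x.2.2.1, x.2.2.2.2.1, x.2.1, x.2.2.2.2.2)
      left_inv := fun _ => rfl
      right_inv := fun _ => rfl }
  refine Fintype.sum_equiv e _ _ fun x => ?_
  simp only [e, Equiv.coe_fn_mk]
  ring

theorem trace_tensorState_onBC [Fintype κ] [Fintype μ] (H : Matrix (Fin d × κ) (Fin d × κ) ℂ)
    (X Y : Matrix (Fin d) (Fin d) ℂ) (G G' : Matrix κ μ ℂ) :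
    ((tensorState Y G')ᴴ * (onBC H * tensorState X G)).trace
      = (contractRight H G' G * (Xᵀ * Yᵀᴴ)).trace := by
  simp only [trace, diag_apply, mul_apply (M := (tensorState Y G')ᴴ), Fintype.sum_prod_type,
    onBC_mul_tensorState]
  simp only [mul_apply, contractRight, tensorState, of_apply, conjTranspose_apply, transpose_apply,
    Finset.mul_sum, Finset.sum_mul, star_mul', ← Fintype.sum_prod_type']
  let e : μ × Fin d × Fin d × κ × Fin d × κ ≃ Fin d × Fin d × Fin d × μ × κ × κ :=
    { toFun := fun x => (x.2.2.1, x.2.2.2.2.1, x.2.1, x.1, x.2.2.2.1, x.2.2.2.2.2)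
      invFun := fun x => (x.2.2.2.1, x.2.2.1, x.1, x.2.2.2.2.1, x.2.1, x.2.2.2.2.2)
      left_inv := fun _ => rfl
      right_inv := fun _ => rfl }
  refine Fintype.sum_equiv e _ _ fun x => ?_
  simp only [e, Equiv.coe_fn_mk]
  ring

theorem trace_tensorState [Fintype κ] [Fintype μ] (X Y : Matrix (Fin d) (Fin d) ℂ) (G G' : Matrix κ μ ℂ) :
    ((tensorState Y G')ᴴ * tensorState X G).trace = (Yᴴ * X).trace * (G'ᴴ * G).trace := by
  simp only [trace, diag_apply, mul_apply, Fintype.sum_prod_type]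
  simp only [tensorState, of_apply, conjTranspose_apply, Finset.mul_sum,
    Finset.sum_mul, star_mul', ← Fintype.sum_prod_type']
  let e : μ × Fin d × Fin d × κ ≃ (μ × κ) × Fin d × Fin d :=
    { toFun := fun x => ((x.1, x.2.2.2), x.2.2.1, x.2.1)
      invFun := fun x => (x.1.1, x.2.2, x.2.1, x.1.2)
      left_inv := fun _ => rfl
      right_inv := fun _ => rfl }
  refine Fintype.sum_equiv e _ _ fun x => ?_
  simp only [e, Equiv.coe_fn_mk]
  ring

theorem tensorState_sub (X Y : Matrix (Fin d) (Fin d) ℂ) (G : Matrix κ μ ℂ) :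
    tensorState (X - Y) G = tensorState X G - tensorState Y G := by
  ext p l; simp [tensorState, sub_mul]

theorem tensorState_smul (z : ℂ) (X : Matrix (Fin d) (Fin d) ℂ) (G : Matrix κ μ ℂ) :
    tensorState (z • X) G = z • tensorState X G := by
  ext p l; simp [tensorState, mul_assoc]

/-! ### Energies of maximally entangled states and orthogonality of test states -/

/-- `P` is the coefficient matrix of a maximally entangled vector. -/
def IsMaxEntMatrix (P : Matrix (Fin d) (Fin d) ℂ) : Prop :=
  P * Pᴴ = (d : ℂ)⁻¹ • (1 : Matrix (Fin d) (Fin d) ℂ)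

theorem IsMaxEntMatrix.conjTranspose_mul {P : Matrix (Fin d) (Fin d) ℂ} (hP : IsMaxEntMatrix P) :
    Pᴴ * P = (d : ℂ)⁻¹ • (1 : Matrix (Fin d) (Fin d) ℂ) := by
  rcases Nat.eq_zero_or_pos d with rfl | hd
  · exact Subsingleton.elim _ _
  have hd' : (d : ℂ) ≠ 0 := by exact_mod_cast hd.ne'
  have h : P * ((d : ℂ) • Pᴴ) = 1 := by
    rw [mul_smul_comm, hP, smul_smul, mul_inv_cancel₀ hd', one_smul]
  have h' := mul_eq_one_comm.1 h
  rw [smul_mul_assoc] at h'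
  rw [← h', smul_smul, inv_mul_cancel₀ hd', one_smul]

theorem IsMaxEntMatrix.transpose_mul {P : Matrix (Fin d) (Fin d) ℂ} (hP : IsMaxEntMatrix P) :
    Pᵀ * Pᵀᴴ = (d : ℂ)⁻¹ • (1 : Matrix (Fin d) (Fin d) ℂ) := by
  have := congrArg Matrix.transpose hP.conjTranspose_mul
  rw [Matrix.transpose_mul, transpose_smul, transpose_one] at this
  exact this

theorem IsMaxEntMatrix.trace_eq_one (hd : d ≠ 0) {P : Matrix (Fin d) (Fin d) ℂ}
    (hP : IsMaxEntMatrix P) : (Pᴴ * P).trace = 1 := by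
  have hd' : (d : ℂ) ≠ 0 := by exact_mod_cast hd
  rw [hP.conjTranspose_mul, trace_smul, trace_one, Fintype.card_fin, smul_eq_mul,
    inv_mul_cancel₀ hd']

/-- All maximally entangled vectors have the same energy, for a given state of the mediator. -/
theorem energy_eq_of_isMaxEntMatrix [Fintype κ] [Fintype μ] (HA HB : Matrix (Fin d × κ) (Fin d × κ) ℂ)
    (G : Matrix κ μ ℂ) {P P' : Matrix (Fin d) (Fin d) ℂ} (hP : IsMaxEntMatrix P)
    (hP' : IsMaxEntMatrix P') :
    ((tensorState P G)ᴴ * ((onAC HA + onBC HB) * tensorState P G)).trace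
      = ((tensorState P' G)ᴴ * ((onAC HA + onBC HB) * tensorState P' G)).trace := by
  simp only [Matrix.add_mul, Matrix.mul_add, trace_add, trace_tensorState_onAC, trace_tensorState_onBC]
  -- Both marginals are maximally mixed, so neither interaction term distinguishes `P` from `P'`.
  rw [hP.transpose_mul, hP'.transpose_mul, hP, hP']

/-- A Hamiltonian without direct coupling of `A` and `B` does not change both local states of a
product vector at once. -/
theorem hamiltonian_orthogonal [Fintype κ] [Fintype μ] (HA HB : Matrix (Fin d × κ) (Fin d × κ) ℂ)
    (G G' : Matrix κ μ ℂ) {Y : Matrix (Fin d) (Fin d) ℂ} {α β : Fin d → ℂ}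
    (hα : α ᵥ* Yᵀᴴ = 0) (hβ : β ᵥ* Yᴴ = 0) :
    ((tensorState Y G')ᴴ * ((onAC HA + onBC HB) * tensorState (vecMulVec α β) G)).trace = 0 := by
  simp only [Matrix.add_mul, Matrix.mul_add, trace_add, trace_tensorState_onAC, trace_tensorState_onBC,
    transpose_vecMulVec, vecMulVec_mul, hα, hβ]
  simp

theorem state_orthogonal [Fintype κ] [Fintype μ] (G G' : Matrix κ μ ℂ) {Y : Matrix (Fin d) (Fin d) ℂ} {α β : Fin d → ℂ}
    (hβ : β ᵥ* Yᴴ = 0) :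
    ((tensorState Y G')ᴴ * tensorState (vecMulVec α β) G).trace = 0 := by
  rw [trace_tensorState, trace_mul_comm, vecMulVec_mul, hβ]
  simp

/-- Parallelogram identity for the form of `N`, with the nonnegative half-sum term dropped. -/
theorem energy_half_sub_le [Fintype μ] {n : Type*} [Fintype n] {N : Matrix n n ℂ} (hN : N.PosSemidef)
    (Z W : Matrix n μ ℂ) :
    (((1 / 2 : ℂ) • (Z - W))ᴴ * (N * ((1 / 2 : ℂ) • (Z - W)))).trace.re
      ≤ ((Zᴴ * (N * Z)).trace.re + (Wᴴ * (N * W)).trace.re) / 2 := by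
  have h0 : 0 ≤ (((1 / 2 : ℂ) • (Z + W))ᴴ * (N * ((1 / 2 : ℂ) • (Z + W)))).trace.re := by
    rw [← Matrix.mul_assoc]
    exact (Complex.nonneg_iff.1 (hN.conjTranspose_mul_mul_same _).trace_nonneg).1
  have e : (((1 / 2 : ℂ) • (Z - W))ᴴ * (N * ((1 / 2 : ℂ) • (Z - W)))).trace
      + (((1 / 2 : ℂ) • (Z + W))ᴴ * (N * ((1 / 2 : ℂ) • (Z + W)))).trace
      = (1 / 2 : ℂ) * ((Zᴴ * (N * Z)).trace + (Wᴴ * (N * W)).trace) := by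
    simp only [conjTranspose_smul, conjTranspose_add, conjTranspose_sub, Matrix.smul_mul,
      Matrix.mul_smul, Matrix.add_mul, Matrix.sub_mul, Matrix.mul_add, Matrix.mul_sub, trace_add, trace_sub, trace_smul,
      smul_eq_mul]
    simp only [star_div₀, star_one, star_ofNat]
    ring
  have e' := congrArg Complex.re e
  rw [Complex.add_re] at e'
  have : ((1 / 2 : ℂ) * ((Zᴴ * (N * Z)).trace + (Wᴴ * (N * W)).trace)).re
      = ((Zᴴ * (N * Z)).trace.re + (Wᴴ * (N * W)).trace.re) / 2 := by
    rw [show (1 / 2 : ℂ) = ((1 / 2 : ℝ) : ℂ) by norm_num, Complex.re_ofReal_mul, Complex.add_re]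
    ring
  linarith

/-! ### Diagonalisation of traces and of the propagator -/

theorem trace_conjTranspose_mul_eq_sum [Fintype μ] {n : Type*} [Fintype n] (X Y : Matrix n μ ℂ) :
    (Xᴴ * Y).trace = ∑ i : n × μ, star (X i.1 i.2) * Y i.1 i.2 := by
  rw [Fintype.sum_prod_type, Finset.sum_comm]
  simp [trace, mul_apply]

theorem trace_conj_diagonal [Fintype μ] {n : Type*} [Fintype n] [DecidableEq n] (V : Matrix n n ℂ) (φ : n → ℂ)
    (X Y : Matrix n μ ℂ) :
    (Xᴴ * ((V * diagonal φ * Vᴴ) * Y)).trace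
      = ∑ i : n × μ, star ((Vᴴ * X) i.1 i.2) * (φ i.1 * (Vᴴ * Y) i.1 i.2) := by
  have : Xᴴ * ((V * diagonal φ * Vᴴ) * Y) = (Vᴴ * X)ᴴ * (diagonal φ * (Vᴴ * Y)) := by
    simp only [conjTranspose_mul, conjTranspose_conjTranspose, Matrix.mul_assoc]
  rw [this, trace_conjTranspose_mul_eq_sum]
  simp [diagonal_mul]

theorem spectral_decomposition {n : Type*} [Fintype n] [DecidableEq n] {M : Matrix n n ℂ}
    (hM : M.IsHermitian) :
    ∃ (V : Matrix n n ℂ), V * Vᴴ = 1 ∧ Vᴴ * V = 1 ∧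
      M = V * diagonal (fun i => (hM.eigenvalues i : ℂ)) * Vᴴ := by
  refine ⟨hM.eigenvectorUnitary, ?_, ?_, ?_⟩
  · exact Unitary.coe_mul_star_self hM.eigenvectorUnitary
  · exact Unitary.coe_star_mul_self hM.eigenvectorUnitary
  · conv_lhs => rw [hM.spectral_theorem, Unitary.conjStarAlgAut_apply]
    rfl

theorem exp_conj_diagonal {n : Type*} [Fintype n] [DecidableEq n] {V : Matrix n n ℂ}
    (hV : V * Vᴴ = 1) (z : ℂ) (φ : n → ℂ) :
    NormedSpace.exp (z • (V * diagonal φ * Vᴴ))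
      = V * diagonal (fun i => Complex.exp (z * φ i)) * Vᴴ := by
  have hinv : V⁻¹ = Vᴴ := inv_eq_right_inv hV
  have hu : IsUnit V := IsUnit.of_mul_eq_one _ hV
  rw [← hinv, ← smul_mul_assoc, ← mul_smul_comm, exp_conj _ _ hu, ← diagonal_smul, exp_diagonal]
  congr 3
  ext i
  rw [Pi.coe_exp]
  simp [Complex.exp_eq_exp_ℂ]

/-! ### Pure reduced states and signed averages -/

theorem sum_mul_star_of_traceRight [Fintype κ] [Fintype μ] {F : Matrix ((Fin d × Fin d) × κ) μ ℂ}
    {v : Fin d × Fin d → ℂ} (h : traceRight (F * Fᴴ) = ketbra v) (y : Fin d × Fin d → ℂ) :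
    ∑ c, ∑ l, (∑ p, y p * F (p, c) l) * star (∑ p, y p * F (p, c) l)
      = (∑ p, y p * v p) * star (∑ p, y p * v p) := by
  have h' : ∀ p p', ∑ c, ∑ l, F (p, c) l * star (F (p', c) l) = v p * star (v p') := by
    intro p p'
    have := congrFun (congrFun h p) p'
    simpa [traceRight, ketbra, mul_apply, vecMulVec_apply] using this
  calc _ = ∑ p, ∑ p', y p * star (y p') * ∑ c, ∑ l, F (p, c) l * star (F (p', c) l) := by
        simp only [star_sum, star_mul', Finset.sum_mul_sum]
        simp only [Finset.mul_sum, ← Fintype.sum_prod_type']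
        let e : κ × μ × (Fin d × Fin d) × (Fin d × Fin d)
            ≃ (Fin d × Fin d) × (Fin d × Fin d) × κ × μ :=
          { toFun := fun x => (x.2.2.1, x.2.2.2, x.1, x.2.1)
            invFun := fun x => (x.2.2.1, x.2.2.2, x.1, x.2.1)
            left_inv := fun _ => rfl
            right_inv := fun _ => rfl }
        refine Fintype.sum_equiv e _ _ fun x => ?_
        simp only [e, Equiv.coe_fn_mk]
        ring
    _ = _ := by
        simp only [h', star_sum, star_mul', Finset.sum_mul_sum]
        refine Finset.sum_congr rfl fun p _ => Finset.sum_congr rfl fun p' _ => ?_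
        ring

/-- If the reduced state of `A ⊗ B` is pure, the state is a product with respect to `AB : C`. -/
theorem exists_eq_tensorState_of_traceRight [Fintype κ] [Fintype μ]
    {F : Matrix ((Fin d × Fin d) × κ) μ ℂ}
    {P : Matrix (Fin d) (Fin d) ℂ} (hP : (Pᴴ * P).trace = 1)
    (h : traceRight (F * Fᴴ) = ketbra fun p => P p.1 p.2) :
    ∃ G : Matrix κ μ ℂ, F = tensorState P G := by
  have hP' : ∑ p : Fin d × Fin d, star (P p.1 p.2) * P p.1 p.2 = 1 := by
    rw [← hP, trace_conjTranspose_mul_eq_sum]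
  refine ⟨of fun c l => ∑ p : Fin d × Fin d, star (P p.1 p.2) * F (p, c) l, ?_⟩
  ext ⟨p, c⟩ l
  -- Row `p` of the projection orthogonal to the unit vector `P`. It annihilates `P`, so by purity
  -- the squared norms of its values on all columns of `F` sum to zero.
  set y : Fin d × Fin d → ℂ := fun p' => (if p' = p then 1 else 0) - P p.1 p.2 * star (P p'.1 p'.2)
    with hy
  have hyv : ∑ p', y p' * P p'.1 p'.2 = 0 := by
    simp only [hy, sub_mul, Finset.sum_sub_distrib, mul_assoc, ← Finset.mul_sum, hP']
    simp
  have hyF : ∀ c l, ∑ p', y p' * F (p', c) l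
      = F (p, c) l - P p.1 p.2 * ∑ p' : Fin d × Fin d, star (P p'.1 p'.2) * F (p', c) l := by
    intro c l
    simp only [hy, sub_mul, Finset.sum_sub_distrib, mul_assoc, ← Finset.mul_sum]
    simp
  have hsum := sum_mul_star_of_traceRight h y
  rw [hyv, zero_mul] at hsum
  have hz : ∀ z : ℂ, z * star z = ((‖z‖ ^ 2 : ℝ) : ℂ) := by
    intro z
    rw [← Complex.normSq_eq_norm_sq]
    exact Complex.mul_conj z
  simp only [hz] at hsum
  norm_cast at hsum
  have h1 := (Finset.sum_eq_zero_iff_of_nonneg (fun c _ =>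
    Finset.sum_nonneg fun l _ => sq_nonneg _)).1 hsum c (Finset.mem_univ c)
  have h2 := (Finset.sum_eq_zero_iff_of_nonneg (fun l _ => sq_nonneg _)).1 h1 l (Finset.mem_univ l)
  have h3 : ∑ p', y p' * F (p', c) l = 0 := by simpa using h2
  rw [hyF, sub_eq_zero] at h3
  simpa [tensorState] using h3

/-- A signed average of coefficient matrices of maximally entangled vectors. -/
def IsMaxEntAverage (Y : Matrix (Fin d) (Fin d) ℂ) : Prop :=
  ∃ X₁ X₂ X₃ X₄ : Matrix (Fin d) (Fin d) ℂ, IsMaxEntMatrix X₁ ∧ IsMaxEntMatrix X₂ ∧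
    IsMaxEntMatrix X₃ ∧ IsMaxEntMatrix X₄ ∧
    Y = (1 / 2 : ℂ) • ((1 / 2 : ℂ) • (X₁ - X₂) - (1 / 2 : ℂ) • (X₃ - X₄))

theorem energy_le_of_isMaxEntAverage [Fintype κ] [Fintype μ]
    {N : Matrix ((Fin d × Fin d) × κ) ((Fin d × Fin d) × κ) ℂ} (hN : N.PosSemidef)
    (G : Matrix κ μ ℂ) {E : ℝ} (hE : ∀ X : Matrix (Fin d) (Fin d) ℂ, IsMaxEntMatrix X →
      ((tensorState X G)ᴴ * (N * tensorState X G)).trace.re = E)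
    {Y : Matrix (Fin d) (Fin d) ℂ} (hY : IsMaxEntAverage Y) :
    ((tensorState Y G)ᴴ * (N * tensorState Y G)).trace.re ≤ E := by
  obtain ⟨X₁, X₂, X₃, X₄, h₁, h₂, h₃, h₄, rfl⟩ := hY
  have h12 := energy_half_sub_le hN (tensorState X₁ G) (tensorState X₂ G)
  have h34 := energy_half_sub_le hN (tensorState X₃ G) (tensorState X₄ G)
  rw [hE _ h₁, hE _ h₂, ← tensorState_sub, ← tensorState_smul] at h12
  rw [hE _ h₃, hE _ h₄, ← tensorState_sub, ← tensorState_smul] at h34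
  have h := energy_half_sub_le hN (tensorState ((1 / 2 : ℂ) • (X₁ - X₂)) G)
    (tensorState ((1 / 2 : ℂ) • (X₃ - X₄)) G)
  rw [← tensorState_sub, ← tensorState_smul] at h
  linarith

theorem posSemidef_sub_smul_one {n : Type*} [Fintype n] [DecidableEq n] {M : Matrix n n ℂ}
    (hM : M.IsHermitian) {E : ℝ} (hE : ∀ i, E ≤ hM.eigenvalues i) :
    (M - (E : ℂ) • (1 : Matrix n n ℂ)).PosSemidef := by
  obtain ⟨V, hV, -, hMV⟩ := spectral_decomposition hM
  have : M - (E : ℂ) • (1 : Matrix n n ℂ)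
      = V * diagonal (fun i => ((hM.eigenvalues i - E : ℝ) : ℂ)) * Vᴴ := by
    have e : diagonal (fun i => ((hM.eigenvalues i - E : ℝ) : ℂ))
        = diagonal (fun i => (hM.eigenvalues i : ℂ)) - (E : ℂ) • (1 : Matrix n n ℂ) := by
      ext i j
      by_cases h : i = j <;> simp [h, one_apply]
    rw [e, mul_sub, sub_mul, ← hMV, mul_smul_comm, mul_one, smul_mul_assoc, hV]
  rw [this]
  refine PosSemidef.mul_mul_conjTranspose_same (PosSemidef.diagonal fun i => ?_) V
  simpa using hE i

theorem groundEnergy_le_eigenvalues {n : Type*} [Fintype n] [DecidableEq n] {M : Matrix n n ℂ}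
    (hM : M.IsHermitian) (i : n) : groundEnergy M ≤ hM.eigenvalues i := by
  refine csInf_le ?_ (hM.eigenvalues_mem_spectrum_real i)
  exact (Matrix.finite_real_spectrum).bddBelow

theorem isHermitian_onAC {H : Matrix (Fin d × κ) (Fin d × κ) ℂ} (hH : H.IsHermitian) :
    (onAC H).IsHermitian := by
  ext p q
  simp only [conjTranspose_apply, onAC, of_apply, eq_comm (a := q.1.2)]
  split_ifs
  · exact hH.apply _ _
  · simp

theorem isHermitian_onBC {H : Matrix (Fin d × κ) (Fin d × κ) ℂ} (hH : H.IsHermitian) :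
    (onBC H).IsHermitian := by
  ext p q
  simp only [conjTranspose_apply, onBC, of_apply, eq_comm (a := q.1.1)]
  split_ifs
  · exact hH.apply _ _
  · simp

theorem star_mul_ofReal_mul_self (x : ℝ) (z : ℂ) :
    star z * ((x : ℂ) * z) = ((x * ‖z‖ ^ 2 : ℝ) : ℂ) := by
  rw [← Complex.normSq_eq_norm_sq, Complex.ofReal_mul, Complex.normSq_eq_conj_mul_self]
  simp only [Complex.star_def]
  ring

theorem norm_trace_conjTranspose_mul_sq_le [Fintype κ] [Fintype μ] (X Y : Matrix κ μ ℂ) :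
    ‖(Xᴴ * Y).trace‖ ^ 2 ≤ (Xᴴ * X).trace.re * (Yᴴ * Y).trace.re := by
  have hself : ∀ Z : Matrix κ μ ℂ, (Zᴴ * Z).trace.re = ∑ i : κ × μ, ‖Z i.1 i.2‖ ^ 2 := by
    intro Z
    rw [trace_conjTranspose_mul_eq_sum, Complex.re_sum]
    refine Finset.sum_congr rfl fun i _ => ?_
    have := star_mul_ofReal_mul_self 1 (Z i.1 i.2)
    rw [Complex.ofReal_one, one_mul, one_mul] at this
    rw [this, Complex.ofReal_re]
  rw [hself, hself, trace_conjTranspose_mul_eq_sum]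
  refine le_trans (pow_le_pow_left₀ (norm_nonneg _) (norm_sum_le _ _) 2) ?_
  simp only [norm_mul, norm_star]
  exact Finset.sum_mul_sq_le_sq_mul_sq _ _ _

/-! ### Spectral data of the mediated evolution -/

/-- The spectral data of a mediated evolution from a product state to a maximally entangled one. The
index `i` runs over energy eigenstates, with energies `e i`; the components of the initial state are
`s i`, and those of the test state with coefficient matrix `Y` are `q i`. -/
theorem exists_spectral_data [Fintype κ] [DecidableEq κ] [Fintype μ] (hd : d ≠ 0)
    {HA HB : Matrix (Fin d × κ) (Fin d × κ) ℂ} (hA : HA.IsHermitian) (hB : HB.IsHermitian)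
    {α β : Fin d → ℂ} {G G' : Matrix κ μ ℂ} {T : ℝ} {P Y : Matrix (Fin d) (Fin d) ℂ}
    (hαβ : ((vecMulVec α β)ᴴ * vecMulVec α β).trace = 1) (hG : (Gᴴ * G).trace = 1)
    (hP : IsMaxEntMatrix P) (hY : IsMaxEntAverage Y) (hα : α ᵥ* Yᵀᴴ = 0) (hβ : β ᵥ* Yᴴ = 0)
    (hF : NormedSpace.exp ((-(Complex.I * (T : ℂ))) • (onAC HA + onBC HB))
      * tensorState (vecMulVec α β) G = tensorState P G') :
    ∃ (e : ((Fin d × Fin d) × κ) × μ → ℝ) (s q : ((Fin d × Fin d) × κ) × μ → ℂ),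
      (∀ i, groundEnergy (onAC HA + onBC HB) ≤ e i) ∧ ∑ i, ‖s i‖ ^ 2 = 1 ∧
      ∑ i, e i * ‖s i‖ ^ 2 = ((tensorState (vecMulVec α β) G)ᴴ
        * ((onAC HA + onBC HB) * tensorState (vecMulVec α β) G)).trace.re ∧
      ∑ i, e i ^ 2 * ‖s i‖ ^ 2 = ((tensorState (vecMulVec α β) G)ᴴ
        * ((onAC HA + onBC HB) * (onAC HA + onBC HB) * tensorState (vecMulVec α β) G)).trace.re ∧
      ∑ i, star (q i) * s i = 0 ∧ ∑ i, star (q i) * (e i * s i) = 0 ∧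
      ∑ i, (e i - groundEnergy (onAC HA + onBC HB)) * ‖q i‖ ^ 2
        ≤ ∑ i, (e i - groundEnergy (onAC HA + onBC HB)) * ‖s i‖ ^ 2 ∧
      ‖∑ i, star (q i) * (Complex.exp (-(Complex.I * T) * e i) * s i)‖ = ‖(Yᴴ * P).trace‖ ∧
      ‖∑ i, Complex.exp (-(Complex.I * T) * e i) * (‖s i‖ ^ 2 : ℝ)‖
        ≤ ‖((vecMulVec α β)ᴴ * P).trace‖ := by
  set M := onAC HA + onBC HB with hMdef
  set S := tensorState (vecMulVec α β) G with hS
  set F := tensorState P G' with hFdef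
  set Q := tensorState Y G' with hQ
  set E₀ := groundEnergy M with hE₀
  have hM : M.IsHermitian := (isHermitian_onAC hA).add (isHermitian_onBC hB)
  obtain ⟨V, hV, hV', hMV⟩ := spectral_decomposition hM
  have hU := exp_conj_diagonal hV (-(Complex.I * (T : ℂ))) (fun i => (hM.eigenvalues i : ℂ))
  rw [← hMV] at hU
  set e : ((Fin d × Fin d) × κ) × μ → ℝ := fun i => hM.eigenvalues i.1 with he
  set s : ((Fin d × Fin d) × κ) × μ → ℂ := fun i => (Vᴴ * S) i.1 i.2 with hs
  set q : ((Fin d × Fin d) × κ) × μ → ℂ := fun i => (Vᴴ * Q) i.1 i.2 with hq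
  set u : ((Fin d × Fin d) × κ) × μ → ℂ := fun i => Complex.exp (-(Complex.I * T) * e i) with hu
  have hunorm : ∀ i, ‖u i‖ = 1 := by
    intro i
    have : -(Complex.I * T) * (e i : ℂ) = ((-(T * e i) : ℝ) : ℂ) * Complex.I := by push_cast; ring
    simp only [hu]
    rw [this, Complex.norm_exp_ofReal_mul_I]
  have hin : ∀ X Z : Matrix ((Fin d × Fin d) × κ) μ ℂ, (Xᴴ * Z).trace
      = ∑ i : ((Fin d × Fin d) × κ) × μ, star ((Vᴴ * X) i.1 i.2) * (Vᴴ * Z) i.1 i.2 := by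
    intro X Z
    have := trace_conj_diagonal V (fun _ => (1 : ℂ)) X Z
    rw [show diagonal (fun _ => (1 : ℂ)) = (1 : Matrix _ _ ℂ) from diagonal_one, Matrix.mul_one, hV,
      Matrix.one_mul] at this
    simpa using this
  have hinM : ∀ X Z : Matrix ((Fin d × Fin d) × κ) μ ℂ, (Xᴴ * (M * Z)).trace
      = ∑ i : ((Fin d × Fin d) × κ) × μ, star ((Vᴴ * X) i.1 i.2) * (e i * (Vᴴ * Z) i.1 i.2) := by
    intro X Z
    have h := trace_conj_diagonal V (fun i => (hM.eigenvalues i : ℂ)) X Z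
    rwa [← hMV] at h
  have hinMM : ∀ X Z : Matrix ((Fin d × Fin d) × κ) μ ℂ, (Xᴴ * (M * M * Z)).trace
      = ∑ i : ((Fin d × Fin d) × κ) × μ,
        star ((Vᴴ * X) i.1 i.2) * (((e i ^ 2 : ℝ) : ℂ) * (Vᴴ * Z) i.1 i.2) := by
    intro X Z
    have : M * M = V * diagonal (fun i => ((hM.eigenvalues i ^ 2 : ℝ) : ℂ)) * Vᴴ := by
      have e1 : diagonal (fun i => ((hM.eigenvalues i ^ 2 : ℝ) : ℂ))
          = diagonal (fun i => (hM.eigenvalues i : ℂ)) * diagonal (fun i => (hM.eigenvalues i : ℂ)) := by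
        rw [diagonal_mul_diagonal]
        congr 1; ext i; push_cast; ring
      conv_lhs => rw [hMV]
      rw [e1]
      calc _ = V * diagonal (fun i => (hM.eigenvalues i : ℂ)) * (Vᴴ * V)
            * (diagonal (fun i => (hM.eigenvalues i : ℂ)) * Vᴴ) := by simp only [Matrix.mul_assoc]
        _ = _ := by rw [hV', Matrix.mul_one]; simp only [Matrix.mul_assoc]
    rw [this, trace_conj_diagonal V]
  have hinU : ∀ X : Matrix ((Fin d × Fin d) × κ) μ ℂ, (Xᴴ * F).trace
      = ∑ i : ((Fin d × Fin d) × κ) × μ, star ((Vᴴ * X) i.1 i.2) * (u i * s i) := by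
    intro X
    rw [← hF, hU, trace_conj_diagonal V]
  have hfs : ∀ i : ((Fin d × Fin d) × κ) × μ, (Vᴴ * F) i.1 i.2 = u i * s i := by
    intro i
    have : Vᴴ * F = diagonal (fun i => Complex.exp (-(Complex.I * T) * hM.eigenvalues i))
        * (Vᴴ * S) := by
      rw [← hF, hU]
      simp only [← Matrix.mul_assoc]
      rw [hV', Matrix.one_mul]
    rw [this, diagonal_mul]
  have hreal : ∀ (x : ((Fin d × Fin d) × κ) × μ → ℝ) (z : ((Fin d × Fin d) × κ) × μ → ℂ),
      ∑ i, star (z i) * ((x i : ℂ) * z i) = ((∑ i, x i * ‖z i‖ ^ 2 : ℝ) : ℂ) := by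
    intro x z
    rw [Complex.ofReal_sum]
    exact Finset.sum_congr rfl fun i _ => star_mul_ofReal_mul_self _ _
  have hone : ∀ z : ((Fin d × Fin d) × κ) × μ → ℂ,
      ∑ i, star (z i) * z i = ((∑ i, ‖z i‖ ^ 2 : ℝ) : ℂ) := by
    intro z
    simpa using hreal (fun _ => 1) z
  have hfnorm : ∀ i : ((Fin d × Fin d) × κ) × μ, ‖(Vᴴ * F) i.1 i.2‖ = ‖s i‖ := by
    intro i; rw [hfs, norm_mul, hunorm, one_mul]
  have hSS : ∑ i, ‖s i‖ ^ 2 = 1 := by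
    have h1 : (Sᴴ * S).trace = 1 := by rw [hS, trace_tensorState, hαβ, hG, one_mul]
    rw [hin, hone] at h1
    exact_mod_cast h1
  -- The evolution is unitary and `P` is normalised, so the final mediator factor is normalised too.
  have hG' : (G'ᴴ * G').trace = 1 := by
    have h1 : (Fᴴ * F).trace = (G'ᴴ * G').trace := by
      rw [hFdef, trace_tensorState, hP.trace_eq_one hd, one_mul]
    rw [← h1, hin, hone (fun i => (Vᴴ * F) i.1 i.2)]
    simp only [hfnorm, hSS, Complex.ofReal_one]
  refine ⟨e, s, q, fun i => groundEnergy_le_eigenvalues hM i.1, hSS, ?_, ?_, ?_, ?_, ?_, ?_, ?_⟩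
  · rw [hinM, hreal, Complex.ofReal_re]
  · rw [hinMM, hreal (fun i => e i ^ 2), Complex.ofReal_re]
  · have := state_orthogonal (α := α) G G' hβ
    rwa [hin] at this
  · have := hamiltonian_orthogonal HA HB G G' hα hβ
    rwa [hinM] at this
  · have hsub : ∀ Z : Matrix ((Fin d × Fin d) × κ) μ ℂ,
        (Zᴴ * ((M - (E₀ : ℂ) • (1 : Matrix _ _ ℂ)) * Z)).trace.re
          = ∑ i : ((Fin d × Fin d) × κ) × μ, (e i - E₀) * ‖(Vᴴ * Z) i.1 i.2‖ ^ 2 := by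
      intro Z
      rw [Matrix.sub_mul, Matrix.mul_sub, trace_sub, Matrix.smul_mul, Matrix.one_mul,
        Matrix.mul_smul, trace_smul, hinM, hin, hreal e (fun i => (Vᴴ * Z) i.1 i.2),
        hone (fun i => (Vᴴ * Z) i.1 i.2), smul_eq_mul, ← Complex.ofReal_mul, ← Complex.ofReal_sub,
        Complex.ofReal_re, Finset.mul_sum, ← Finset.sum_sub_distrib]
      exact Finset.sum_congr rfl fun i _ => by ring
    have hpsd := posSemidef_sub_smul_one hM (E := E₀) (groundEnergy_le_eigenvalues hM)
    have hle := energy_le_of_isMaxEntAverage hpsd G' (E := ∑ i, (e i - E₀) * ‖s i‖ ^ 2) ?_ hY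
    · rwa [hsub] at hle
    · intro X hX
      -- Any maximally entangled `X` may be replaced by `P`, giving the evolved state; its spectral
      -- weights are those of the initial state, so energy is conserved.
      have h1 : ((tensorState X G')ᴴ * ((M - (E₀ : ℂ) • (1 : Matrix _ _ ℂ))
          * tensorState X G')).trace
          = (Fᴴ * ((M - (E₀ : ℂ) • (1 : Matrix _ _ ℂ)) * F)).trace := by
        simp only [Matrix.sub_mul, Matrix.mul_sub, trace_sub, Matrix.smul_mul, Matrix.one_mul,
          Matrix.mul_smul, trace_smul]
        rw [hMdef, energy_eq_of_isMaxEntMatrix HA HB G' hX hP, hFdef, trace_tensorState,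
          trace_tensorState, hX.trace_eq_one hd, hP.trace_eq_one hd]
      rw [h1, hsub]
      simp only [hfnorm]
  · have h1 := hinU Q
    rw [hQ, hFdef, trace_tensorState, hG', mul_one] at h1
    rw [h1]
  · have h1 := hinU S
    have h2 : ∑ i, star (s i) * (u i * s i) = ∑ i, u i * ((‖s i‖ ^ 2 : ℝ) : ℂ) := by
      refine Finset.sum_congr rfl fun i _ => ?_
      have := star_mul_ofReal_mul_self 1 (s i)
      rw [Complex.ofReal_one, one_mul, one_mul] at this
      rw [← this]; ring
    rw [← h2, ← h1, hS, hFdef, trace_tensorState, norm_mul]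
    have h3 := norm_trace_conjTranspose_mul_sq_le G G'
    rw [hG, hG', Complex.one_re, one_mul] at h3
    have h4 : ‖(Gᴴ * G').trace‖ ≤ 1 := by
      nlinarith [norm_nonneg (Gᴴ * G').trace]
    exact mul_le_of_le_one_right (norm_nonneg _) h4

/-! ### Construction of the test matrices -/

theorem trace_vecMulVec_conjTranspose_mul_self {α β : Fin d → ℂ} (hα : star α ⬝ᵥ α = 1)
    (hβ : star β ⬝ᵥ β = 1) : ((vecMulVec α β)ᴴ * vecMulVec α β).trace = 1 := by
  rw [conjTranspose_vecMulVec, vecMulVec_mul_vecMulVec, hα, one_smul, trace_vecMulVec, hβ]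

theorem isMaxEntMatrix_mul_left {R P : Matrix (Fin d) (Fin d) ℂ} (hR : R * Rᴴ = 1)
    (hP : IsMaxEntMatrix P) : IsMaxEntMatrix (R * P) := by
  unfold IsMaxEntMatrix at hP ⊢
  rw [conjTranspose_mul, Matrix.mul_assoc, ← Matrix.mul_assoc P, hP, smul_mul_assoc, one_mul,
    mul_smul_comm, hR]

theorem isMaxEntMatrix_mul_right {R P : Matrix (Fin d) (Fin d) ℂ} (hR : R * Rᴴ = 1)
    (hP : IsMaxEntMatrix P) : IsMaxEntMatrix (P * R) := by
  unfold IsMaxEntMatrix at hP ⊢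
  rw [conjTranspose_mul, Matrix.mul_assoc, ← Matrix.mul_assoc R, hR, one_mul, hP]

theorem reflection_mul_conjTranspose {v : Fin d → ℂ} (hv : star v ⬝ᵥ v = 1) :
    ((2 : ℂ) • vecMulVec v (star v) - 1) * ((2 : ℂ) • vecMulVec v (star v) - 1)ᴴ = 1 := by
  have h : vecMulVec v (star v) * vecMulVec v (star v) = vecMulVec v (star v) := by
    rw [vecMulVec_mul_vecMulVec, hv, one_smul]
  rw [conjTranspose_sub, conjTranspose_smul, conjTranspose_vecMulVec, star_star, conjTranspose_one]
  simp only [sub_mul, mul_sub, smul_mul_assoc, mul_smul_comm, h, one_mul, mul_one]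
  have : star (2 : ℂ) = 2 := by simp
  rw [this]
  module

/-- The part of a coefficient matrix in which the states of `A` and of `B` are orthogonal to `α` and
to `β`. -/
def doublyExcited (α β : Fin d → ℂ) (P : Matrix (Fin d) (Fin d) ℂ) : Matrix (Fin d) (Fin d) ℂ :=
  (1 - vecMulVec α (star α)) * P * (1 - vecMulVec (star β) β)

/-- Each projection is `(1 - R) / 2` with `R` a reflection, and local unitaries preserve maximal
entanglement. Expanding gives the four matrices `P`, `R P`, `P R'`, `R P R'`. -/
theorem isMaxEntAverage_doublyExcited {α β : Fin d → ℂ} (hα : star α ⬝ᵥ α = 1)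
    (hβ : star β ⬝ᵥ β = 1) {P : Matrix (Fin d) (Fin d) ℂ} (hP : IsMaxEntMatrix P) :
    IsMaxEntAverage (doublyExcited α β P) := by
  have hβ' : star (star β) ⬝ᵥ star β = 1 := by rw [star_star, dotProduct_comm]; exact hβ
  have hA := reflection_mul_conjTranspose hα
  have hB := reflection_mul_conjTranspose hβ'
  rw [star_star] at hB
  refine ⟨P, _, _, _, hP, isMaxEntMatrix_mul_left hA hP, isMaxEntMatrix_mul_right hB hP,
    isMaxEntMatrix_mul_right hB (isMaxEntMatrix_mul_left hA hP), ?_⟩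
  unfold doublyExcited
  simp only [sub_mul, mul_sub, smul_mul_assoc, mul_smul_comm, one_mul, mul_one]
  module

theorem vecMul_doublyExcited_conjTranspose {α β : Fin d → ℂ} (hβ : star β ⬝ᵥ β = 1)
    (P : Matrix (Fin d) (Fin d) ℂ) : β ᵥ* (doublyExcited α β P)ᴴ = 0 := by
  have h : β ᵥ* (1 - vecMulVec (star β) β)ᴴ = 0 := by
    rw [conjTranspose_sub, conjTranspose_one, conjTranspose_vecMulVec, star_star, vecMul_sub,
      vecMul_one, vecMul_vecMulVec, dotProduct_comm, hβ, one_smul, sub_self]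
  rw [doublyExcited, conjTranspose_mul, ← vecMul_vecMul, h, zero_vecMul]

theorem vecMul_doublyExcited_transpose_conjTranspose {α β : Fin d → ℂ} (hα : star α ⬝ᵥ α = 1)
    (P : Matrix (Fin d) (Fin d) ℂ) : α ᵥ* (doublyExcited α β P)ᵀᴴ = 0 := by
  have h : α ᵥ* (1 - vecMulVec α (star α))ᵀᴴ = 0 := by
    rw [transpose_sub, transpose_one, transpose_vecMulVec, conjTranspose_sub, conjTranspose_one,
      conjTranspose_vecMulVec, star_star, vecMul_sub,
      vecMul_one, vecMul_vecMulVec, dotProduct_comm, hα, one_smul, sub_self]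
  rw [doublyExcited, Matrix.mul_assoc, transpose_mul, conjTranspose_mul, ← vecMul_vecMul, h,
    zero_vecMul]

theorem trace_vecMulVec_conjTranspose_mul (α β : Fin d → ℂ) (P : Matrix (Fin d) (Fin d) ℂ) :
    ((vecMulVec α β)ᴴ * P).trace = star β ⬝ᵥ (star α ᵥ* P) := by
  rw [conjTranspose_vecMulVec, vecMulVec_mul, trace_vecMulVec]

theorem trace_conjTranspose_mul_projection_mul {α : Fin d → ℂ} (hα : star α ⬝ᵥ α = 1)
    {P : Matrix (Fin d) (Fin d) ℂ} (hP : IsMaxEntMatrix P) :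
    (Pᴴ * (vecMulVec α (star α) * P)).trace = (d : ℂ)⁻¹ := by
  rw [trace_mul_comm, Matrix.mul_assoc, hP, mul_smul_comm, mul_one, trace_smul, trace_vecMulVec,
    dotProduct_comm, hα, smul_eq_mul, mul_one]

/-- Cauchy–Schwarz after inserting the projection onto `α`, which has expectation `1/d` in a
maximally mixed marginal. -/
theorem norm_overlap_sq_le {α β : Fin d → ℂ} (hα : star α ⬝ᵥ α = 1)
    (hβ : star β ⬝ᵥ β = 1) {P : Matrix (Fin d) (Fin d) ℂ} (hP : IsMaxEntMatrix P) :
    ‖((vecMulVec α β)ᴴ * P).trace‖ ^ 2 ≤ (d : ℝ)⁻¹ := by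
  have h := norm_trace_conjTranspose_mul_sq_le (vecMulVec α β) (vecMulVec α (star α) * P)
  have h1 : (vecMulVec α β)ᴴ * (vecMulVec α (star α) * P) = (vecMulVec α β)ᴴ * P := by
    rw [← Matrix.mul_assoc, conjTranspose_vecMulVec, vecMulVec_mul_vecMulVec, hα, one_smul]
  have h2 : ((vecMulVec α (star α) * P)ᴴ * (vecMulVec α (star α) * P)).trace = (d : ℂ)⁻¹ := by
    rw [← trace_conjTranspose_mul_projection_mul hα hP, conjTranspose_mul, Matrix.mul_assoc,
      ← Matrix.mul_assoc (vecMulVec α (star α))ᴴ, conjTranspose_vecMulVec, star_star,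
      vecMulVec_mul_vecMulVec, hα, one_smul]
  rw [h1, h2, trace_vecMulVec_conjTranspose_mul_self hα hβ, Complex.one_re, one_mul] at h
  rwa [show (d : ℂ)⁻¹ = (((d : ℝ)⁻¹ : ℝ) : ℂ) by push_cast; rfl, Complex.ofReal_re] at h

/-- Inclusion–exclusion: each local projection removes `1/d`, and their product restores the squared
overlap. -/
theorem trace_doublyExcited {α β : Fin d → ℂ} (hd : d ≠ 0) (hα : star α ⬝ᵥ α = 1)
    (hβ : star β ⬝ᵥ β = 1) {P : Matrix (Fin d) (Fin d) ℂ} (hP : IsMaxEntMatrix P) :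
    ((doublyExcited α β P)ᴴ * P).trace
      = ((1 - 2 / d + ‖((vecMulVec α β)ᴴ * P).trace‖ ^ 2 : ℝ) : ℂ) := by
  have e : ((doublyExcited α β P)ᴴ * P).trace = (Pᴴ * P).trace
      - (Pᴴ * (vecMulVec α (star α) * P)).trace - (vecMulVec (star β) β * (Pᴴ * P)).trace
      + (vecMulVec (star β) β * (Pᴴ * (vecMulVec α (star α) * P))).trace := by
    simp only [doublyExcited, conjTranspose_mul, conjTranspose_sub,
      conjTranspose_vecMulVec, star_star, sub_mul, mul_sub, one_mul, mul_one, trace_sub,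
      Matrix.mul_assoc]
    ring
  have h4 : (vecMulVec (star β) β * (Pᴴ * (vecMulVec α (star α) * P))).trace
      = ((‖((vecMulVec α β)ᴴ * P).trace‖ ^ 2 : ℝ) : ℂ) := by
    rw [vecMulVec_mul, trace_vecMulVec_conjTranspose_mul, ← vecMul_vecMul, ← vecMul_vecMul,
      vecMul_vecMulVec, smul_vecMul, trace_vecMulVec, dotProduct_smul, smul_eq_mul,
      ← Complex.normSq_eq_norm_sq, Complex.normSq_eq_conj_mul_self]
    congr 1
    rw [← Complex.star_def, star_dotProduct, star_star, star_vecMul, star_star,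
      ← dotProduct_mulVec, dotProduct_comm β]
  rw [e, h4, hP.trace_eq_one hd, trace_conjTranspose_mul_projection_mul hα hP,
    hP.conjTranspose_mul, mul_smul_comm, mul_one, trace_smul, trace_vecMulVec, hβ]
  push_cast
  simp only [smul_eq_mul]
  ring

theorem exists_orthogonal_qubit {v : Fin 2 → ℂ} (hv : star v ⬝ᵥ v = 1) :
    ∃ v' : Fin 2 → ℂ, star v' ⬝ᵥ v' = 1 ∧ star v' ⬝ᵥ v = 0 ∧ star v ⬝ᵥ v' = 0 ∧
      (1 : Matrix (Fin 2) (Fin 2) ℂ) - vecMulVec v (star v) = vecMulVec v' (star v') := by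
  have h : star (v 0) * v 0 + star (v 1) * v 1 = 1 := by
    simpa [dotProduct, Fin.sum_univ_two] using hv
  have h' := h
  simp only [Complex.star_def] at h'
  refine ⟨![-star (v 1), star (v 0)], ?_, ?_, ?_, ?_⟩
  · simp only [dotProduct, Fin.sum_univ_two, Pi.star_apply, cons_val_zero, cons_val_one, star_neg,
      star_star]
    linear_combination h
  · simp only [dotProduct, Fin.sum_univ_two, Pi.star_apply, cons_val_zero, cons_val_one, star_neg,
      star_star]
    ring
  · simp only [dotProduct, Fin.sum_univ_two, Pi.star_apply, cons_val_zero, cons_val_one]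
    ring
  · ext i j
    fin_cases i <;> fin_cases j <;> simp [vecMulVec_apply]
    · linear_combination (-1 : ℂ) * h'
    · ring
    · ring
    · linear_combination (-1 : ℂ) * h'

/-- For qubits the constant `1 - 2/d` vanishes and the doubly excited part of `P` may be too short.
Its direction `α'β'` can be rescaled to length `1/√2`, being half the difference of the Bell-type
vectors `(αβ ± α'β') / √2`. -/
theorem exists_test_matrix_qubit {α β : Fin 2 → ℂ} (hα : star α ⬝ᵥ α = 1)
    (hβ : star β ⬝ᵥ β = 1) {P : Matrix (Fin 2) (Fin 2) ℂ} (hP : IsMaxEntMatrix P) :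
    ∃ Y : Matrix (Fin 2) (Fin 2) ℂ, IsMaxEntAverage Y ∧ α ᵥ* Yᵀᴴ = 0 ∧ β ᵥ* Yᴴ = 0 ∧
      ‖(Yᴴ * P).trace‖ ^ 2 = ‖((vecMulVec α β)ᴴ * P).trace‖ ^ 2 / 2 := by
  obtain ⟨α', hα', hαα', hα'α, hA⟩ := exists_orthogonal_qubit hα
  obtain ⟨β', hβ', hββ', hβ'β, hB⟩ := exists_orthogonal_qubit hβ
  have hB' : (1 : Matrix (Fin 2) (Fin 2) ℂ) - vecMulVec (star β) β = vecMulVec (star β') β' := by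
    have := congrArg Matrix.transpose hB
    rwa [transpose_sub, transpose_one, transpose_vecMulVec, transpose_vecMulVec] at this
  set c : ℂ := (((Real.sqrt 2)⁻¹ : ℝ) : ℂ) with hc
  have hcc : c * star c = 1 / 2 := by
    rw [hc, Complex.star_def, Complex.conj_ofReal, ← Complex.ofReal_mul, ← mul_inv,
      Real.mul_self_sqrt (by norm_num)]
    norm_num
  have hmax : ∀ ε : ℂ, ε * star ε = 1 →
      IsMaxEntMatrix (c • (vecMulVec α β + ε • vecMulVec α' β')) := by
    intro ε hε
    have hsum : vecMulVec α (star α) + vecMulVec α' (star α') = 1 := by rw [← hA]; abel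
    have h1 : (vecMulVec α β + ε • vecMulVec α' β') * (vecMulVec α β + ε • vecMulVec α' β')ᴴ
        = 1 := by
      simp only [conjTranspose_add, conjTranspose_smul, conjTranspose_vecMulVec, add_mul, mul_add,
        smul_mul_assoc, mul_smul_comm, vecMulVec_mul_vecMulVec, dotProduct_comm β,
        dotProduct_comm β', hβ, hβ', hββ', hβ'β, zero_smul, one_smul, vecMulVec_zero, smul_zero,
        add_zero, zero_add, smul_smul]
      rw [mul_comm, hε, one_smul, hsum]
    unfold IsMaxEntMatrix
    rw [conjTranspose_smul, smul_mul_assoc, mul_smul_comm, smul_smul, h1, hcc]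
    norm_num
  refine ⟨c • vecMulVec α' β', ?_, ?_, ?_, ?_⟩
  · have h1 := hmax 1 (by simp)
    have h2 := hmax (-1) (by simp)
    refine ⟨_, _, _, _, h1, h2, h2, h1, ?_⟩
    module
  · rw [transpose_smul, transpose_vecMulVec, conjTranspose_smul, conjTranspose_vecMulVec,
      vecMul_smul, vecMul_vecMulVec, dotProduct_comm, hαα', zero_smul, smul_zero]
  · rw [conjTranspose_smul, conjTranspose_vecMulVec,
      vecMul_smul, vecMul_vecMulVec, dotProduct_comm, hββ', zero_smul, smul_zero]
  · set w' := ((vecMulVec α' β')ᴴ * P).trace with hw'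
    have hdE : doublyExcited α β P = w' • vecMulVec α' β' := by
      rw [doublyExcited, hA, hB', vecMulVec_mul, vecMulVec_mul_vecMulVec, hw',
        trace_vecMulVec_conjTranspose_mul, dotProduct_comm, vecMulVec_smul]
    -- With `1 - 2/d = 0` this trace formula says that `αβ` and `α'β'` have overlaps of equal
    -- modulus with `P`.
    have htr := trace_doublyExcited two_ne_zero hα hβ hP
    rw [hdE, conjTranspose_smul, smul_mul_assoc, trace_smul, ← hw', smul_eq_mul, Complex.star_def,
      ← Complex.normSq_eq_conj_mul_self, Complex.normSq_eq_norm_sq] at htr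
    have htr' : ‖w'‖ ^ 2 = ‖((vecMulVec α β)ᴴ * P).trace‖ ^ 2 := by
      have := Complex.ofReal_injective htr
      rw [this]; norm_num
    have hcn : ‖c‖ ^ 2 = 1 / 2 := by
      rw [hc, Complex.norm_real, Real.norm_eq_abs, sq_abs, inv_pow, Real.sq_sqrt (by norm_num)]
      norm_num
    rw [conjTranspose_smul, smul_mul_assoc, trace_smul, ← hw', smul_eq_mul, norm_mul, norm_star,
      mul_pow, hcn, htr']
    ring

/-! ### Numerical contradictions for the mean-energy bound -/

theorem qubit_energy_bound {a b m k : ℝ} (hm : 0 ≤ m) (hm' : m ≤ Real.pi / 4)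
    (hk : (a ^ 2 + b ^ 2) / 2 ≤ k) (h : k + (1 - a) ^ 2 + b ^ 2 ≤ 9 / 20 * m ^ 2 + 3 / 5 * m * b) :
    False := by
  have hpi := Real.pi_lt_d4
  have hm2 : m ^ 2 ≤ 0.7854 ^ 2 := pow_le_pow_left₀ hm (by linarith) 2
  -- The squares vanish at the minimising `a` and `b`; what remains is `1/3 ≤ 0.51 * m ^ 2`, false
  -- for `m ≤ 0.7854`.
  nlinarith [sq_nonneg (a - 2 / 3), sq_nonneg (b - m / 5)]

theorem qudit_energy_bound {a b m k u : ℝ} (hu0 : 0 ≤ u) (hu : u ^ 2 ≤ 1 / 3) (hm : 0 ≤ m)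
    (hm' : m ≤ Real.pi / 2 - u) (hk : 1 - 2 * u ^ 2 + (a ^ 2 + b ^ 2) ≤ k)
    (h : k ^ 2 + (1 - a) ^ 2 + b ^ 2 ≤ 9 / 20 * m ^ 2 + 3 / 5 * m * b) : False := by
  have hpi := Real.pi_lt_d4
  set t := u ^ 2 with ht
  have ht0 : 0 ≤ t := sq_nonneg u
  -- Since `u ≤ 1/√3`, the linear term in `u` is traded for one in `t = u ^ 2`, leaving polynomials
  -- in `t` on `[0, 1/3]`.
  have hut : 1.732 * t ≤ u := by
    have : 1.732 * u ≤ 1 := by nlinarith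
    nlinarith
  have hm2 : m ^ 2 ≤ 2.4675 - 3.1414 * u + t := by
    have : m ^ 2 ≤ (1.5708 - u) ^ 2 := pow_le_pow_left₀ hm (by linarith) 2
    nlinarith
  have hk2 : (1 - 2 * t) ^ 2 + 2 * (1 - 2 * t) * (a ^ 2 + b ^ 2) ≤ k ^ 2 := by
    have h0 : 0 ≤ 1 - 2 * t + (a ^ 2 + b ^ 2) := by nlinarith [sq_nonneg a, sq_nonneg b]
    nlinarith [pow_le_pow_left₀ h0 hk 2, sq_nonneg (a ^ 2 + b ^ 2)]
  have hm3 : m ^ 2 ≤ 2.4675 - 5.44 * t + t := by nlinarith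
  have hW : 0 < 3 - 4 * t := by linarith
  have h1 : (1 - 2 * t) ^ 2 + 1 + (3 - 4 * t) * (a ^ 2 + b ^ 2) - 2 * a - 3 / 5 * m * b
      - 9 / 20 * m ^ 2 ≤ 0 := by nlinarith
  -- Elimination of `a` and `b` by completing squares, after multiplying by their common leading
  -- coefficient `3 - 4 * t`.
  have h2 : (3 - 4 * t) * ((1 - 2 * t) ^ 2 + 1) - 1 - m ^ 2 * (1.44 - 1.8 * t) ≤ 0 := by
    nlinarith [mul_nonneg hW.le (neg_nonneg.2 h1), sq_nonneg ((3 - 4 * t) * a - 1),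
      sq_nonneg ((3 - 4 * t) * b - 3 / 10 * m)]
  have h3 : m ^ 2 * (1.44 - 1.8 * t) ≤ (2.4675 - 4.44 * t) * (1.44 - 1.8 * t) :=
    mul_le_mul_of_nonneg_right (by linarith) (by linarith)
  have hv : 0 ≤ 1 / 3 - t := by linarith
  nlinarith [mul_nonneg ht0 hv, mul_nonneg (mul_nonneg ht0 hv) hv, mul_nonneg (mul_nonneg ht0 ht0) hv,
    mul_nonneg hv hv]

/-- Moving the zero of energy is a global phase. It is used with the ground level for the mean and
with the average energy for the spread. -/
theorem norm_sum_exp_shift {ι : Type*} [Fintype ι] (e : ι → ℝ) (z : ι → ℂ) (T E : ℝ) :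
    ‖∑ i, Complex.exp (-(Complex.I * (T * (e i - E) : ℝ))) * z i‖
      = ‖∑ i, Complex.exp (-(Complex.I * T) * e i) * z i‖ := by
  have : ∀ i, Complex.exp (-(Complex.I * (T * (e i - E) : ℝ))) * z i
      = Complex.exp ((T * E : ℝ) * Complex.I) * (Complex.exp (-(Complex.I * T) * e i) * z i) := by
    intro i
    rw [← mul_assoc, ← Complex.exp_add]
    congr 2
    push_cast
    ring
  simp only [this, ← Finset.mul_sum]
  rw [norm_mul, Complex.norm_exp_ofReal_mul_I, one_mul]

theorem sum_cos_sq_add_sum_sin_sq {ι : Type*} [Fintype ι] (l : ι → ℝ) (p : ι → ℝ) :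
    (∑ i, Real.cos (l i) * p i) ^ 2 + (∑ i, Real.sin (l i) * p i) ^ 2
      = ‖∑ i, Complex.exp (-(Complex.I * l i)) * (p i : ℂ)‖ ^ 2 := by
  have : ∑ i, Complex.exp (-(Complex.I * l i)) * (p i : ℂ)
      = ⟨∑ i, Real.cos (l i) * p i, -∑ i, Real.sin (l i) * p i⟩ := by
    have h : ∀ t : ℝ, Complex.exp (-(Complex.I * t)) = ⟨Real.cos t, -Real.sin t⟩ := by
      intro t
      rw [show -(Complex.I * (t : ℂ)) = ((-t : ℝ) : ℂ) * Complex.I by push_cast; ring,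
        Complex.exp_mul_I]
      apply Complex.ext <;>
        simp [← Complex.ofReal_cos, ← Complex.ofReal_sin, -Complex.ofReal_neg]
    apply Complex.ext <;> simp [h]
  rw [this, ← Complex.normSq_eq_norm_sq, Complex.normSq_mk]
  ring

theorem arccos_one_div_sqrt_two : Real.arccos (1 / Real.sqrt (2 : ℕ)) = Real.pi / 4 := by
  have : 1 / Real.sqrt (2 : ℕ) = Real.cos (Real.pi / 4) := by
    rw [Real.cos_pi_div_four, Nat.cast_ofNat]
    rw [div_eq_div_iff (by positivity) (by norm_num), one_mul, Real.mul_self_sqrt (by norm_num)]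
  rw [this, Real.arccos_cos (by positivity) (by linarith [Real.pi_pos])]

theorem arccos_le_pi_div_two_sub {u : ℝ} (hu0 : 0 ≤ u) (hu1 : u ≤ 1) :
    Real.arccos u ≤ Real.pi / 2 - u := by
  have hpi := Real.pi_gt_three
  have : u ≤ Real.arcsin u := by
    rw [Real.le_arcsin_iff_sin_le ⟨by linarith, by linarith⟩ ⟨by linarith, hu1⟩]
    exact Real.sin_le hu0
  rw [Real.arccos]
  linarith

/-! ### The strict bound at a single entangling time -/

theorem arccos_lt_of_evolution [Fintype κ] [DecidableEq κ] (hd : 2 ≤ d)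
    {HA HB : Matrix (Fin d × κ) (Fin d × κ) ℂ} (hA : HA.IsHermitian) (hB : HB.IsHermitian)
    {α β : Fin d → ℂ} (hα : star α ⬝ᵥ α = 1) (hβ : star β ⬝ᵥ β = 1)
    {G G' : Matrix κ κ ℂ} (hG : (Gᴴ * G).trace = 1)
    (hres : ResourceEquality (onAC HA + onBC HB)
      (tensorState (vecMulVec α β) G * (tensorState (vecMulVec α β) G)ᴴ))
    {T : ℝ} (hT : 0 ≤ T) {P : Matrix (Fin d) (Fin d) ℂ} (hP : IsMaxEntMatrix P)
    (hF : NormedSpace.exp ((-(Complex.I * (T : ℂ))) • (onAC HA + onBC HB))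
      * tensorState (vecMulVec α β) G = tensorState P G') :
    Real.arccos (1 / Real.sqrt d) < T := by
  have hd0 : d ≠ 0 := by omega
  have hdR : (2 : ℝ) ≤ d := by exact_mod_cast hd
  set u : ℝ := 1 / Real.sqrt d with hu
  have hsq : 0 < Real.sqrt d := Real.sqrt_pos.2 (by linarith)
  have hu0 : 0 < u := by positivity
  have hu2 : u ^ 2 = (d : ℝ)⁻¹ := by rw [hu, div_pow, one_pow, Real.sq_sqrt (by linarith), one_div]
  have hu1 : u < 1 := by
    have : u ^ 2 < 1 := by rw [hu2]; exact inv_lt_one_of_one_lt₀ (by linarith)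
    nlinarith
  set θ := Real.arccos u with hθ
  have hθ0 : 0 < θ := Real.arccos_pos.2 hu1
  have hθ2 : θ ≤ Real.pi / 2 := Real.arccos_le_pi_div_two.2 hu0.le
  have hcosθ : Real.cos θ = u := Real.cos_arccos (by linarith) hu1.le
  have hαβ := trace_vecMulVec_conjTranspose_mul_self hα hβ
  set w := ((vecMulVec α β)ᴴ * P).trace with hw
  have hwd : ‖w‖ ^ 2 ≤ u ^ 2 := by rw [hu2]; exact norm_overlap_sq_le hα hβ hP
  have htr := trace_doublyExcited hd0 hα hβ hP
  rw [← hw] at htr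
  have htest := exists_spectral_data hd0 hA hB hαβ hG hP (isMaxEntAverage_doublyExcited hα hβ hP)
    (vecMul_doublyExcited_transpose_conjTranspose hα P) (vecMul_doublyExcited_conjTranspose hβ P) hF
  set M := onAC HA + onBC HB with hM
  set S := tensorState (vecMulVec α β) G with hS
  have htrM : (M * (S * Sᴴ)).trace = (Sᴴ * (M * S)).trace := by
    rw [← Matrix.mul_assoc, trace_mul_comm]
  have htrMM : (M * M * (S * Sᴴ)).trace = (Sᴴ * (M * M * S)).trace := by
    rw [← Matrix.mul_assoc, trace_mul_comm]
  by_contra! hTθ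
  -- `T = 0` is separate because the refined bound divides by the mean `m = T`; there the overlap
  -- would be at least 1, against `u < 1`.
  rcases eq_or_lt_of_le hT with hT0 | hTpos
  · obtain ⟨e, s, q, -, hs, -, -, -, -, -, -, h8⟩ := htest
    rw [← hT0] at h8
    have h1 : (∑ i, ((‖s i‖ ^ 2 : ℝ) : ℂ)) = 1 := by rw [← Complex.ofReal_sum, hs]; simp
    simp only [Complex.ofReal_zero, mul_zero, neg_zero, zero_mul, Complex.exp_zero, one_mul, h1,
      norm_one] at h8
    nlinarith
  have hres' : meanEnergy M (S * Sᴴ) = 1 ∨ energySD M (S * Sᴴ) = 1 := by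
    unfold ResourceEquality at hres
    rcases min_choice (meanEnergy M (S * Sᴴ)) (energySD M (S * Sᴴ)) with h | h
    · left; rw [← h, hres]
    · right; rw [← h, hres]
  rcases hres' with hmean | hsd
  · -- the mean energy is the scarce resource
    rw [meanEnergy, htrM] at hmean
    have key : ∀ Y : Matrix (Fin d) (Fin d) ℂ, IsMaxEntAverage Y → α ᵥ* Yᵀᴴ = 0 → β ᵥ* Yᴴ = 0 →
        ∃ a b : ℝ, a ^ 2 + b ^ 2 ≤ ‖w‖ ^ 2 ∧
          ‖(Yᴴ * P).trace‖ ^ 2 + (1 - a) ^ 2 + b ^ 2 ≤ 9 / 20 * T ^ 2 + 3 / 5 * T * b := by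
      intro Y hY hαY hβY
      obtain ⟨e, s, q, he, hs, h2, -, h4, h5, h6, h7, h8⟩ :=
        exists_spectral_data hd0 hA hB hαβ hG hP hY hαY hβY hF
      rw [← hM] at he h2 h6
      set E := groundEnergy M with hE
      set l : _ → ℝ := fun i => T * (e i - E) with hl
      have hmeanE : ∑ i, (e i - E) * ‖s i‖ ^ 2 = 1 := by
        simp only [sub_mul, Finset.sum_sub_distrib, ← Finset.mul_sum, hs, h2]
        linarith
      have hls : ∑ i, l i * ‖s i‖ ^ 2 = T := by
        simp only [hl, mul_assoc, ← Finset.mul_sum, hmeanE, mul_one]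
      have hlq : ∑ i, l i * ‖q i‖ ^ 2 ≤ T := by
        simp only [hl, mul_assoc, ← Finset.mul_sum]
        rw [hmeanE] at h6
        nlinarith
      have hqls : ∑ i, star (q i) * ((l i : ℂ) * s i) = 0 := by
        have : ∀ i, star (q i) * ((l i : ℂ) * s i)
            = T * (star (q i) * (e i * s i)) - T * E * (star (q i) * s i) := by
          intro i; simp only [hl]; push_cast; ring
        simp only [this, Finset.sum_sub_distrib, ← Finset.mul_sum, h4, h5, mul_zero, sub_zero]
      have hml := margolus_levitin_refined l s q
        (fun i => mul_nonneg hT (sub_nonneg.2 (he i))) hTpos hs hls hlq h4 hqls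
      refine ⟨∑ i, Real.cos (l i) * ‖s i‖ ^ 2, ∑ i, Real.sin (l i) * ‖s i‖ ^ 2, ?_, ?_⟩
      · rw [sum_cos_sq_add_sum_sin_sq l (fun i => ‖s i‖ ^ 2), norm_sum_exp_shift]
        exact pow_le_pow_left₀ (norm_nonneg _) h8 2
      · have h9 : ‖∑ i, star (q i) * (Complex.exp (-(Complex.I * l i)) * s i)‖
            = ‖(Yᴴ * P).trace‖ := by
          rw [← h7]
          simp only [mul_left_comm (star _)]
          exact norm_sum_exp_shift e _ T E
        rwa [h9] at hml
    rcases eq_or_lt_of_le hd with rfl | hd3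
    · obtain ⟨Y, hY, hαY, hβY, hYP⟩ := exists_test_matrix_qubit hα hβ hP
      obtain ⟨a, b, hab, hineq⟩ := key Y hY hαY hβY
      rw [hYP, ← hw] at hineq
      refine qubit_energy_bound hT ?_ (by linarith) hineq
      rwa [hθ, hu, arccos_one_div_sqrt_two] at hTθ
    · obtain ⟨a, b, hab, hineq⟩ := key _ (isMaxEntAverage_doublyExcited hα hβ hP)
        (vecMul_doublyExcited_transpose_conjTranspose hα P)
        (vecMul_doublyExcited_conjTranspose hβ P)
      have hd3R : (3 : ℝ) ≤ d := by exact_mod_cast hd3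
      rw [htr, Complex.norm_real, Real.norm_eq_abs, sq_abs] at hineq
      refine qudit_energy_bound hu0.le ?_ hT
        (hTθ.trans (arccos_le_pi_div_two_sub hu0.le hu1.le)) ?_ hineq
      · rw [hu2, one_div]
        exact inv_anti₀ (by norm_num) hd3R
      · rw [hu2, ← div_eq_mul_inv]
        linarith
  · -- the energy spread is the scarce resource
    obtain ⟨e, s, q, he, hs, h2, h3, h4, h5, -, h7, h8⟩ := htest
    rw [energySD, Real.sqrt_eq_one, htrM, htrMM, ← h2, ← h3] at hsd
    set E := ∑ i, e i * ‖s i‖ ^ 2 with hE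
    set l : _ → ℝ := fun i => T * (e i - E) with hl
    have hls : ∑ i, l i ^ 2 * ‖s i‖ ^ 2 ≤ θ ^ 2 := by
      have : ∀ i, l i ^ 2 * ‖s i‖ ^ 2 = T ^ 2 * (e i ^ 2 * ‖s i‖ ^ 2)
          - T ^ 2 * (2 * E) * (e i * ‖s i‖ ^ 2) + T ^ 2 * E ^ 2 * ‖s i‖ ^ 2 := by
        intro i; simp only [hl]; ring
      simp only [this, Finset.sum_sub_distrib, Finset.sum_add_distrib, ← Finset.mul_sum, hs, ← hE]
      have hT2 : T ^ 2 ≤ θ ^ 2 := pow_le_pow_left₀ hT hTθ 2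
      calc _ = T ^ 2 * (∑ i, e i ^ 2 * ‖s i‖ ^ 2 - E ^ 2) := by ring
        _ ≤ θ ^ 2 := by rw [hsd, mul_one]; exact hT2
    have hqls : ∑ i, star (q i) * ((l i : ℂ) * s i) = 0 := by
      have : ∀ i, star (q i) * ((l i : ℂ) * s i)
          = T * (star (q i) * (e i * s i)) - T * E * (star (q i) * s i) := by
        intro i; simp only [hl]; push_cast; ring
      simp only [this, Finset.sum_sub_distrib, ← Finset.mul_sum, h4, h5, mul_zero, sub_zero]
    have hk : ‖∑ i, star (q i) * (Complex.exp (-(Complex.I * l i)) * s i)‖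
        = |1 - 2 / d + ‖w‖ ^ 2| := by
      rw [← Real.norm_eq_abs, ← Complex.norm_real, ← htr, ← h7]
      simp only [mul_left_comm (star _)]
      exact norm_sum_exp_shift e _ T E
    have hab : (∑ i, Real.cos (l i) * ‖s i‖ ^ 2) ^ 2 + (∑ i, Real.sin (l i) * ‖s i‖ ^ 2) ^ 2
        ≤ ‖w‖ ^ 2 := by
      rw [sum_cos_sq_add_sum_sin_sq l (fun i => ‖s i‖ ^ 2), norm_sum_exp_shift]
      exact pow_le_pow_left₀ (norm_nonneg _) h8 2
    have hle := mandelstam_tamm l s hθ0 hθ2 hs hls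
    rw [hcosθ] at hle
    -- Needed for `d = 2`, where `1 - 2/d` vanishes: the non-strict bound already forces a nonzero
    -- overlap, so the test vector detects the evolved state.
    have hwpos : 0 < ‖w‖ ^ 2 := by
      nlinarith [sq_nonneg (∑ i, Real.sin (l i) * ‖s i‖ ^ 2)]
    have hd2 : 2 / (d : ℝ) ≤ 1 := by rw [div_le_one (by linarith)]; exact hdR
    have hne : ∑ i, star (q i) * (Complex.exp (-(Complex.I * l i)) * s i) ≠ 0 := by
      rw [← norm_ne_zero_iff, hk]
      exact abs_ne_zero.2 (by linarith)
    have hlt := mandelstam_tamm_strict l s q hθ0 hθ2 hs hls h4 hqls hne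
    rw [hcosθ] at hlt
    nlinarith [sq_nonneg (∑ i, Real.sin (l i) * ‖s i‖ ^ 2)]

/-! ### Closedness of the entangling times and translation of the hypotheses -/

/-- Compactness makes the set of maximally entangled density matrices closed, so a nonempty set of
entangling times contains its infimum. -/
theorem isCompact_isMaxEntMatrix :
    IsCompact {P : Matrix (Fin d) (Fin d) ℂ | IsMaxEntMatrix P} := by
  have hK : IsCompact (Set.univ.pi fun _ : Fin d => Set.univ.pi fun _ : Fin d =>
      Metric.closedBall (0 : ℂ) 1) :=
    isCompact_univ_pi fun _ => isCompact_univ_pi fun _ => isCompact_closedBall _ _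
  refine IsCompact.of_isClosed_subset hK ?_ ?_
  · exact isClosed_eq (by fun_prop) continuous_const
  · intro P hP a _ b _
    rw [mem_closedBall_zero_iff]
    have h := congrFun (congrFun hP a) a
    simp only [mul_apply, conjTranspose_apply, Matrix.smul_apply, one_apply_eq, smul_eq_mul, mul_one] at h
    have h' : ∑ b, ‖P a b‖ ^ 2 = (d : ℝ)⁻¹ := by
      have : ∀ z : ℂ, z * star z = ((‖z‖ ^ 2 : ℝ) : ℂ) := by
        intro z
        rw [← Complex.normSq_eq_norm_sq]
        exact Complex.mul_conj z
      simp only [this] at h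
      apply Complex.ofReal_injective
      push_cast at h ⊢
      exact h
    have h1 : ‖P a b‖ ^ 2 ≤ ∑ b, ‖P a b‖ ^ 2 :=
      Finset.single_le_sum (f := fun b => ‖P a b‖ ^ 2) (fun _ _ => sq_nonneg _) (Finset.mem_univ b)
    have h2 : (d : ℝ)⁻¹ ≤ 1 := Nat.cast_inv_le_one d
    nlinarith [norm_nonneg (P a b)]

theorem continuous_traceRight_evolve [Fintype κ] [DecidableEq κ]
    (M ρ : Matrix ((Fin d × Fin d) × κ) ((Fin d × Fin d) × κ) ℂ) :
    Continuous fun T : ℝ => traceRight (evolve M ρ T) := by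
  have hexp : Continuous fun T : ℝ => NormedSpace.exp ((-(Complex.I * (T : ℂ))) • M) := by
    open scoped Matrix.Norms.Operator in
    exact NormedSpace.exp_continuous.comp (by fun_prop)
  have hev : Continuous fun T : ℝ => evolve M ρ T := by
    unfold evolve
    fun_prop
  refine continuous_matrix fun i j => ?_
  simp only [traceRight, of_apply]
  exact continuous_finsetSum _ fun c _ => hev.matrix_elem _ _

theorem of_orthonormalBasis_mul_conjTranspose
    (z : OrthonormalBasis (Fin d) ℂ (EuclideanSpace ℂ (Fin d))) :
    (of fun j a => z j a : Matrix (Fin d) (Fin d) ℂ)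
      * (of fun j a => z j a : Matrix (Fin d) (Fin d) ℂ)ᴴ = 1 := by
  ext i j
  have h := orthonormal_iff_ite.1 z.orthonormal j i
  rw [PiLp.inner_apply] at h
  simp only [mul_apply, conjTranspose_apply, of_apply, one_apply, eq_comm (a := i)]
  rw [← h]
  rfl

theorem IsMaximallyEntangled.exists_isMaxEntMatrix
    {σ : Matrix (Fin d × Fin d) (Fin d × Fin d) ℂ} (h : IsMaximallyEntangled σ) :
    ∃ P : Matrix (Fin d) (Fin d) ℂ, IsMaxEntMatrix P ∧ σ = ketbra fun p => P p.1 p.2 := by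
  obtain ⟨x, y, rfl⟩ := h
  have hX := mul_eq_one_comm.1 (of_orthonormalBasis_mul_conjTranspose x)
  have hY := of_orthonormalBasis_mul_conjTranspose y
  set X : Matrix (Fin d) (Fin d) ℂ := of fun j a => x j a with hXdef
  set Y : Matrix (Fin d) (Fin d) ℂ := of fun j a => y j a with hYdef
  refine ⟨(((Real.sqrt d)⁻¹ : ℝ) : ℂ) • (Xᵀ * Y), ?_, ?_⟩
  · have hXt : Xᵀ * Xᵀᴴ = 1 := by
      have := congrArg transpose hX
      rwa [transpose_mul, transpose_one] at this
    have hc : (((Real.sqrt d)⁻¹ : ℝ) : ℂ) * star (((Real.sqrt d)⁻¹ : ℝ) : ℂ) = (d : ℂ)⁻¹ := by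
      rw [Complex.star_def, Complex.conj_ofReal, ← Complex.ofReal_mul, ← mul_inv,
        Real.mul_self_sqrt (Nat.cast_nonneg d)]
      simp
    unfold IsMaxEntMatrix
    rw [conjTranspose_smul, smul_mul_smul_comm, hc, conjTranspose_mul, Matrix.mul_assoc,
      ← Matrix.mul_assoc Y, hY, Matrix.one_mul, hXt]
  · rfl

theorem ketbra_productKet_kronecker (α β : EuclideanSpace ℂ (Fin d)) [Fintype κ]
    (G : Matrix κ κ ℂ) :
    ketbra (productKet α β) ⊗ₖ (G * Gᴴ)
      = tensorState (vecMulVec α β) G * (tensorState (vecMulVec α β) G)ᴴ := by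
  ext p q
  simp only [kroneckerMap_apply, ketbra, productKet, vecMulVec_apply, mul_apply, tensorState,
    conjTranspose_apply, of_apply, Pi.star_apply, star_mul', Finset.mul_sum]
  exact Finset.sum_congr rfl fun _ _ => by ring

theorem star_dotProduct_self_of_norm_eq_one {α : EuclideanSpace ℂ (Fin d)} (hα : ‖α‖ = 1) :
    star (α : Fin d → ℂ) ⬝ᵥ α = 1 := by
  have h : inner ℂ α α = 1 := by rw [inner_self_eq_norm_sq_to_K, hα]; simp
  rw [PiLp.inner_apply] at h
  rw [← h]
  simp only [dotProduct, RCLike.inner_apply, Pi.star_apply]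
  exact Finset.sum_congr rfl fun _ _ => mul_comm _ _

theorem exists_eq_mul_conjTranspose [Fintype κ] [DecidableEq κ] {ρ : Matrix κ κ ℂ}
    (hρ : ρ.PosSemidef) : ∃ G : Matrix κ κ ℂ, ρ = G * Gᴴ := by
  open scoped MatrixOrder in
  obtain ⟨B, hB⟩ := CStarAlgebra.nonneg_iff_eq_star_mul_self.1 hρ.nonneg
  exact ⟨Bᴴ, by rw [hB, star_eq_conjTranspose, conjTranspose_conjTranspose]⟩

end MediatedEntangling

open MediatedEntangling Matrix

theorem theorem3 {d : ℕ} (hd : 2 ≤ d) {κ : Type*} [Fintype κ] [DecidableEq κ]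
    (HAC HBC : Matrix (Fin d × κ) (Fin d × κ) ℂ)
    (hAC : HAC.IsHermitian) (hBC : HBC.IsHermitian)
    (α β : EuclideanSpace ℂ (Fin d)) (hα : ‖α‖ = 1) (hβ : ‖β‖ = 1)
    (ρC : Matrix κ κ ℂ) (hρC : MediatedEntangling.IsDensityMatrix ρC)
    (hres : MediatedEntangling.ResourceEquality
      (MediatedEntangling.onAC HAC + MediatedEntangling.onBC HBC)
      (MediatedEntangling.ketbra (MediatedEntangling.productKet α β) ⊗ₖ ρC)) :
    ENNReal.ofReal (Real.arccos (1 / Real.sqrt d)) <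
      MediatedEntangling.entanglingTime
        (MediatedEntangling.onAC HAC + MediatedEntangling.onBC HBC)
        (MediatedEntangling.ketbra (MediatedEntangling.productKet α β) ⊗ₖ ρC) := by
  obtain ⟨hpos, htr⟩ := hρC
  obtain ⟨G, rfl⟩ := exists_eq_mul_conjTranspose hpos
  rw [trace_mul_comm] at htr
  rw [ketbra_productKet_kronecker] at hres ⊢
  set M := onAC HAC + onBC HBC with hM
  set S := tensorState (vecMulVec α β) G with hS
  set K : Set (Matrix (Fin d × Fin d) (Fin d × Fin d) ℂ) :=
    (fun P : Matrix (Fin d) (Fin d) ℂ => ketbra fun p => P p.1 p.2) '' {P | IsMaxEntMatrix P}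
    with hK
  have hKclosed : IsClosed K := by
    refine (isCompact_isMaxEntMatrix.image ?_).isClosed
    refine continuous_matrix fun i j => ?_
    simp only [ketbra, vecMulVec_apply, Pi.star_apply]
    fun_prop
  set A : Set ℝ := {T | 0 ≤ T ∧ traceRight (evolve M (S * Sᴴ) T) ∈ K} with hA
  have hAclosed : IsClosed A :=
    isClosed_Ici.inter (hKclosed.preimage (continuous_traceRight_evolve M (S * Sᴴ)))
  have hAlt : ∀ T ∈ A, Real.arccos (1 / Real.sqrt d) < T := by
    rintro T ⟨hT, P, hP, hPT⟩
    have hev : evolve M (S * Sᴴ) T = (NormedSpace.exp ((-(Complex.I * (T : ℂ))) • M) * S)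
        * (NormedSpace.exp ((-(Complex.I * (T : ℂ))) • M) * S)ᴴ := by
      rw [evolve, conjTranspose_mul]
      simp only [Matrix.mul_assoc]
    rw [hev] at hPT
    obtain ⟨G', hG'⟩ := exists_eq_tensorState_of_traceRight
      (hP.trace_eq_one (by omega)) hPT.symm
    exact arccos_lt_of_evolution hd hAC hBC (star_dotProduct_self_of_norm_eq_one hα)
      (star_dotProduct_self_of_norm_eq_one hβ) htr hres hT hP hG'
  have hmem : ∀ T : ℝ≥0, IsMaximallyEntangled (traceRight (evolve M (S * Sᴴ) T)) →
      (T : ℝ) ∈ A := by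
    intro T hT
    obtain ⟨P, hP, hPT⟩ := hT.exists_isMaxEntMatrix
    exact ⟨T.2, P, hP, hPT.symm⟩
  rcases A.eq_empty_or_nonempty with hempty | hne
  · have : entanglingTime M (S * Sᴴ) = ⊤ := by
      refine iInf₂_eq_top.2 fun T hT => ?_
      have := hmem T hT
      simp [hempty] at this
    rw [this]
    exact ENNReal.ofReal_lt_top
  · have hbdd : BddBelow A := ⟨0, fun T hT => hT.1⟩
    -- The infimum is itself an admissible time, so the strict inequality applies to it directly.
    have hinf := hAclosed.csInf_mem hne hbdd
    have hlt := hAlt _ hinf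
    calc ENNReal.ofReal (Real.arccos (1 / Real.sqrt d)) < ENNReal.ofReal (sInf A) :=
          (ENNReal.ofReal_lt_ofReal_iff_of_nonneg (Real.arccos_nonneg _)).2 hlt
      _ ≤ entanglingTime M (S * Sᴴ) := by
          refine le_iInf₂ fun T hT => ?_
          rw [← ENNReal.ofReal_coe_nnreal]
          exact ENNReal.ofReal_le_ofReal (csInf_le hbdd (hmem T hT))
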